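/- Let $p$ be a prime, $\mathbb{K}=\overline{\mathbb{F}}_p$ and $q$ a power of $p$ with $q>1$. Let $\mathbf{G}$ be a simple linear algebraic group over $\mathbb{K}$ (connected, non-commutative, with no closed connected normal subgroups other than $1$ and $\mathbf{G}$), let $F:\mathbf{G}\to\mathbf{G}$ be the Frobenius endomorphism of an $\mathbb{F}_q$-structure on $\mathbf{G}$, and let $\mathbf{T}$ be an $F$-stable maximal torus of $\mathbf{G}$. Let $\mathbf{G}^{\star}$ be a connected reductive group over $\mathbb{K}$ with Frobenius endomorphism $F^{\star}$ of an $\mathbb{F}_q$-structure and $F^{\star}$-stable maximal torus $\mathbf{T}^{\star}$, such that the triples $(\mathbf{G},\mathbf{T},F)$ and $(\mathbf{G}^{\star},\mathbf{T}^{\star},F^{\star})$ are in duality: there is an isomorphism $\varphi:X(\mathbf{T})\to \check X(\mathbf{T}^{\star})$ from the character group of $\mathbf{T}$ to the cocharacter group of $\mathbf{T}^{\star}$, with transpose $\varphi^{\vee}:X(\mathbf{T}^{\star})\to\check X(\mathbf{T})$, such that $\varphi$ and $\varphi^{\vee}$ map roots bijectively onto coroots, compatibly with the bijections $\alpha\leftrightarrow\alpha^{\vee}$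 between roots and coroots, and $\varphi(\chi\circ F)=F^{\star}\circ\varphi(\chi)$ for all $\chi\in X(\mathbf{T})$. A simply connected cover of a group $\mathbf{H}$ with maximal torus $\mathbf{T}_{\mathbf{H}}$ is a central isogeny $\delta:\mathbf{H}_{\mathrm{sc}}\to\mathbf{H}$, where $\mathbf{H}_{\mathrm{sc}}$ is a connected reductive group with a maximal torus $\mathbf{T}_{\mathrm{sc}}$ whose cocharacter group is spanned by its coroots, and $\delta(\mathbf{T}_{\mathrm{sc}})=\mathbf{T}_{\mathbf{H}}$. Here central means that the maps on characters and cocharacters induced by $\delta$ are bijections between the roots and between the coroots, compatible with $\alpha\leftrightarrow\alpha^{\vee}$. Kernels, centres and fixed points are those of the groups of $\mathbb{K}$-points. (a) Let $\delta_{\mathrm{sc}}:\mathbf{G}_{\mathrm{sc}}\to\mathbf{G}$ be a simply connected cover, and let $F$ also denote a Frobenius endomorphism of an $\mathbb{F}_q$-structure on $\mathbf{G}_{\mathrm{sc}}$ with $\delta_{\mathrm{sc}}\circ F=F\circ\delta_{\mathrm{sc}}$. Then $$|\mathrm{Ker}(\delta_{\mathrm{sc}})^F| = |Z(\mathbf{G}^{\star})^{F^{\star}}|.$$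 (b) Let $\delta^{\star}_{\mathrm{sc}}:\mathbf{G}^{\star}_{\mathrm{ad}}\to\mathbf{G}^{\star}$ be a simply connected cover of $\mathbf{G}^{\star}$, and let $F^{\star}$ also denote a Frobenius endomorphism of an $\mathbb{F}_q$-structure on $\mathbf{G}^{\star}_{\mathrm{ad}}$ with $\delta^{\star}_{\mathrm{sc}}\circ F^{\star}=F^{\star}\circ\delta^{\star}_{\mathrm{sc}}$. Suppose that $Z(\mathbf{G})$ is cyclic. If $A\leqslant\mathrm{Ker}(\delta^{\star}_{\mathrm{sc}})$ and $Z\leqslant Z(\mathbf{G})$ are subgroups with $|A|=|Z|$, then $|A^{F^{\star}}|=|Z^F|$, where $A^{F^{\star}}=\{a\in A: F^{\star}(a)=a\}$ and $Z^F=\{z\in Z: F(z)=z\}$. -/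

import Mathlib

/-! ### Linear algebraic groups over an (algebraically closed) field

A linear algebraic group is a Zariski closed subgroup of some `GL n K`, identified with its
group of `K`-points. -/

section AlgebraicGroups

open scoped MatrixGroups

variable {K : Type*} [Field K]

/-- The set of invertible matrices at which all the polynomials of `I` (in the matrix
entries) vanish. -/
def zeroSet {n : ℕ} (I : Set (MvPolynomial (Fin n × Fin n) K)) : Set (GL (Fin n) K) :=
  {g | ∀ P ∈ I, MvPolynomial.eval (fun ij => (g : Matrix (Fin n) (Fin n) K) ij.1 ij.2) P = 0}

/-- The Zariski topology of `GL n K`: the closed sets are the zero sets of sets of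
polynomials. -/
abbrev zariskiTopology (n : ℕ) : TopologicalSpace (GL (Fin n) K) :=
  TopologicalSpace.ofClosed {S | ∃ I, S = zeroSet I}
    ⟨{1}, by ext g; simp [zeroSet]⟩
    (by
      intro A hA
      refine ⟨{P | ∃ I, zeroSet I ∈ A ∧ P ∈ I}, ?_⟩
      ext g
      constructor
      · rintro hg P ⟨I, hI, hPI⟩
        exact hg _ hI P hPI
      · intro hg S hS
        obtain ⟨I, rfl⟩ := hA hS
        intro P hP
        exact hg P ⟨I, hS, hP⟩)
    (by
      rintro _ ⟨I, rfl⟩ _ ⟨J, rfl⟩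
      refine ⟨{R | ∃ P ∈ I, ∃ Q ∈ J, R = P * Q}, ?_⟩
      ext g
      constructor
      · rintro (hg | hg) _ ⟨P, hP, Q, hQ, rfl⟩
        · rw [map_mul, hg P hP, zero_mul]
        · rw [map_mul, hg Q hQ, mul_zero]
      · intro hg
        by_contra hne
        simp only [Set.mem_union, not_or, zeroSet, Set.mem_ofPred_eq, not_forall] at hne
        obtain ⟨⟨P, hP, hP0⟩, Q, hQ, hQ0⟩ := hne
        have h := hg _ ⟨P, hP, Q, hQ, rfl⟩
        rw [map_mul] at h
        exact (mul_ne_zero hP0 hQ0) h)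

attribute [local instance] zariskiTopology

variable (K) in
/-- A linear algebraic group over `K`: a closed subgroup of some `GL n K`. -/
structure LinearAlgebraicGroup where
  n : ℕ
  toSubgroup : Subgroup (GL (Fin n) K)
  isClosed : IsClosed (toSubgroup : Set (GL (Fin n) K))

namespace LinearAlgebraicGroup

instance : CoeSort (LinearAlgebraicGroup K) (Type _) := ⟨fun G => G.toSubgroup⟩

/-- The matrix of an element of `G`. -/
def mat {G : LinearAlgebraicGroup K} (g : G) : Matrix (Fin G.n) (Fin G.n) K :=
  ((g : GL (Fin G.n) K) : Matrix (Fin G.n) (Fin G.n) K)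

/-- The coordinate ring `K[G]`, as an algebra of functions on `G`: it is generated by the
entries of `g` and of its inverse. -/
def coordRing (G : LinearAlgebraicGroup K) : Subalgebra K (G → K) :=
  Algebra.adjoin K
    ({f | ∃ i j, f = fun g => mat g i j} ∪ {f | ∃ i j, f = fun g => mat g⁻¹ i j})

/-- The group `G` is connected in its Zariski topology. -/
def IsConnectedGroup (G : LinearAlgebraicGroup K) : Prop := ConnectedSpace G

/-- `G` is a simple algebraic group: connected, not commutative, and without closed connected
normal subgroups other than `1` and `G`. -/
structure IsSimple (G : LinearAlgebraicGroup K) : Prop where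
  connected : G.IsConnectedGroup
  noncomm : ∃ g h : G, g * h ≠ h * g
  eq_bot_or_top : ∀ N : Subgroup G, N.Normal → IsClosed (N : Set G) → IsConnected (N : Set G) →
    N = ⊥ ∨ N = ⊤

/-- `G` is a connected reductive group: connected, and without non-trivial closed connected
normal unipotent subgroups. -/
structure IsReductive (G : LinearAlgebraicGroup K) : Prop where
  connected : G.IsConnectedGroup
  unipotent_eq_bot : ∀ N : Subgroup G, N.Normal → IsClosed (N : Set G) →
    IsConnected (N : Set G) → (∀ g ∈ N, IsNilpotent (mat g - 1)) → N = ⊥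

/-- The Lie algebra of `G`, that is the tangent space of `G` at `1`, as a subspace of the
space of matrices. -/
def lieAlg (G : LinearAlgebraicGroup K) : Submodule K (Matrix (Fin G.n) (Fin G.n) K) where
  carrier := {A | ∀ P : MvPolynomial (Fin G.n × Fin G.n) K,
    (∀ g : G, MvPolynomial.eval (fun ij => mat g ij.1 ij.2) P = 0) →
    ∑ ij, MvPolynomial.eval (fun kl => (1 : Matrix (Fin G.n) (Fin G.n) K) kl.1 kl.2)
      (MvPolynomial.pderiv ij P) * A ij.1 ij.2 = 0}
  add_mem' := by
    intro A B hA hB P hP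
    simp only [Matrix.add_apply, mul_add, Finset.sum_add_distrib, hA P hP, hB P hP, add_zero]
  zero_mem' := by intro P _; simp
  smul_mem' := by
    intro c A hA P hP
    have h := hA P hP
    simp only [Matrix.smul_apply, smul_eq_mul, mul_left_comm _ c, ← Finset.mul_sum, h, mul_zero]

/-- A homomorphism of algebraic groups: a group homomorphism that is a morphism of
varieties. -/
structure Hom (G H : LinearAlgebraicGroup K) extends G →* H where
  regular : ∀ i j, (fun g : G => mat (toMonoidHom g) i j) ∈ G.coordRing

instance (G H : LinearAlgebraicGroup K) : CoeFun (Hom G H) (fun _ => G → H) :=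
  ⟨fun f => f.toMonoidHom⟩

/-- The kernel of a homomorphism. -/
def Hom.ker {G H : LinearAlgebraicGroup K} (f : Hom G H) : Subgroup G := f.toMonoidHom.ker

/-- An isogeny: a surjective homomorphism with finite kernel (of connected groups). -/
def Hom.IsIsogeny {G H : LinearAlgebraicGroup K} (f : Hom G H) : Prop :=
  Function.Surjective f ∧ Finite f.ker

/-- `F` is the Frobenius endomorphism of an `𝔽_q`-structure on `G`: the functions `h ∈ K[G]`
with `h ∘ F = h ^ q`, which form the `𝔽_q`-form of `K[G]`, span `K[G]` over `K`. -/
def Hom.IsFrobenius {G : LinearAlgebraicGroup K} (q : ℕ) (F : Hom G G) : Prop :=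
  ∀ f ∈ G.coordRing, f ∈ Submodule.span K {h : G → K | h ∈ G.coordRing ∧ ∀ g, h (F g) = h g ^ q}

theorem coordRing_inv {G : LinearAlgebraicGroup K} {f : G → K} (hf : f ∈ G.coordRing) :
    (fun g => f g⁻¹) ∈ G.coordRing := by
  induction hf using Algebra.adjoin_induction with
  | mem f hf =>
    rcases hf with ⟨i, j, rfl⟩ | ⟨i, j, rfl⟩
    · exact Algebra.subset_adjoin (Or.inr ⟨i, j, rfl⟩)
    · exact Algebra.subset_adjoin (Or.inl ⟨i, j, by simp⟩)
  | algebraMap r => exact Subalgebra.algebraMap_mem _ r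
  | add f g _ _ hf hg => exact add_mem hf hg
  | mul f g _ _ hf hg => exact mul_mem hf hg

theorem Hom.comp_mem {G H : LinearAlgebraicGroup K} (φ : Hom G H) {f : H → K}
    (hf : f ∈ H.coordRing) : (fun g => f (φ g)) ∈ G.coordRing := by
  induction hf using Algebra.adjoin_induction with
  | mem f hf =>
    rcases hf with ⟨i, j, rfl⟩ | ⟨i, j, rfl⟩
    · exact φ.regular i j
    · have h := coordRing_inv (φ.regular i j)
      simpa only [map_inv] using h
  | algebraMap r => exact Subalgebra.algebraMap_mem _ r
  | add f g _ _ hf hg => exact add_mem hf hg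
  | mul f g _ _ hf hg => exact mul_mem hf hg

/-! ### Maximal tori, characters and cocharacters -/

/-- The algebra of regular functions on the split torus `(Kˣ)^r` (Laurent polynomials). -/
def laurentRing (K : Type*) [Field K] (r : ℕ) : Subalgebra K ((Fin r → Kˣ) → K) :=
  Algebra.adjoin K
    ({f | ∃ i, f = fun c => (c i : K)} ∪ {f | ∃ i, f = fun c => (((c i)⁻¹ : Kˣ) : K)})

/-- A subgroup `T` of `G` is a torus: it is isomorphic, as an algebraic group, to some
`(Kˣ)^r`. (Regular functions on the closed subset `T` are the restrictions of those on `G`.) -/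
def IsTorus {G : LinearAlgebraicGroup K} (T : Subgroup G) : Prop :=
  IsClosed (T : Set G) ∧ ∃ (r : ℕ) (e : (Fin r → Kˣ) ≃* T),
    (∀ i j, (fun c => mat (e c : G) i j) ∈ laurentRing K r) ∧
    (∀ i, ∃ f ∈ G.coordRing, ∀ t : T, ((e.symm t i : Kˣ) : K) = f t)

/-- A maximal torus of `G`. A torus equal to its own centraliser is contained in no larger
torus (tori are commutative); conversely, in a connected reductive group, every torus that is
maximal under inclusion equals its own centraliser. The latter is used as the definition; all
groups to which it is applied below are connected reductive. -/
structure MaximalTorus (G : LinearAlgebraicGroup K) where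
  toSubgroup : Subgroup G
  isTorus : IsTorus toSubgroup
  centralizer_eq : Subgroup.centralizer (toSubgroup : Set G) = toSubgroup

namespace MaximalTorus

variable {G H : LinearAlgebraicGroup K}

instance : CoeSort (MaximalTorus G) (Type _) := ⟨fun T => T.toSubgroup⟩

instance (T : MaximalTorus G) : CommGroup T where
  mul_comm := by
    obtain ⟨-, r, e, -⟩ := T.isTorus
    intro a b
    apply e.symm.injective
    rw [map_mul, map_mul, mul_comm]

/-- The character group `X(T)`: the homomorphisms of algebraic groups `T → Kˣ`. -/
def characters (T : MaximalTorus G) : Subgroup (T →* Kˣ) where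
  carrier := {χ | ∃ f ∈ G.coordRing, ∀ t : T, (χ t : K) = f t}
  one_mem' := ⟨1, one_mem _, fun _ => rfl⟩
  mul_mem' := by
    rintro χ ψ ⟨f, hf, hχ⟩ ⟨g, hg, hψ⟩
    exact ⟨f * g, mul_mem hf hg, fun t => by simp [hχ, hψ]⟩
  inv_mem' := by
    rintro χ ⟨f, hf, hχ⟩
    refine ⟨_, coordRing_inv hf, fun t => ?_⟩
    have h := hχ t⁻¹
    simpa using h

/-- The algebra of regular functions on `Kˣ` (Laurent polynomials in one variable). -/
def laurentRingOne (K : Type*) [Field K] : Subalgebra K (Kˣ → K) :=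
  Algebra.adjoin K {fun c : Kˣ => (c : K), fun c : Kˣ => ((c⁻¹ : Kˣ) : K)}

theorem laurentRingOne_inv {f : Kˣ → K} (hf : f ∈ laurentRingOne K) :
    (fun c => f c⁻¹) ∈ laurentRingOne K := by
  induction hf using Algebra.adjoin_induction with
  | mem f hf =>
    rcases hf with rfl | rfl
    · exact Algebra.subset_adjoin (Or.inr rfl)
    · exact Algebra.subset_adjoin (Or.inl (by simp))
  | algebraMap r => exact Subalgebra.algebraMap_mem _ r
  | add f g _ _ hf hg => exact add_mem hf hg
  | mul f g _ _ hf hg => exact mul_mem hf hg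

/-- The cocharacter group `Y(T)`: the homomorphisms of algebraic groups `Kˣ → T`. -/
def cocharacters (T : MaximalTorus G) : Subgroup (Kˣ →* T) where
  carrier := {l | ∀ i j, (fun c => mat (l c : G) i j) ∈ laurentRingOne K}
  one_mem' := by
    intro i j
    exact Subalgebra.algebraMap_mem _ ((1 : Matrix (Fin G.n) (Fin G.n) K) i j)
  mul_mem' := by
    intro l m hl hm i j
    have h : (fun c => mat ((l * m) c : G) i j) =
        ∑ k, (fun c => mat (l c : G) i k) * (fun c => mat (m c : G) k j) := by
      funext c
      simp [mat, Matrix.mul_apply]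
    rw [h]
    exact sum_mem fun k _ => mul_mem (hl i k) (hm k j)
  inv_mem' := by
    intro l hl i j
    have h := laurentRingOne_inv (hl i j)
    simpa using h

/-- The homomorphism `T → S` of maximal tori induced by `f : G → H` with `f(T) ⊆ S`. -/
def restrict {T : MaximalTorus G} {S : MaximalTorus H} (f : Hom G H)
    (h : ∀ t : T, f t ∈ S.toSubgroup) : T →* S where
  toFun t := ⟨f t, h t⟩
  map_one' := Subtype.ext (f.toMonoidHom.map_one)
  map_mul' a b := Subtype.ext (f.toMonoidHom.map_mul (a : G) (b : G))

/-- The map `X(S) → X(T)`, `χ ↦ χ ∘ f`, induced by `f`. -/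
def pullback {T : MaximalTorus G} {S : MaximalTorus H} (f : Hom G H)
    (h : ∀ t : T, f t ∈ S.toSubgroup) (χ : S.characters) : T.characters :=
  ⟨χ.1.comp (restrict f h), by
    obtain ⟨u, hu, hχ⟩ := χ.2
    exact ⟨_, f.comp_mem hu, fun t => hχ _⟩⟩

theorem laurentRingOne_comp (T : MaximalTorus G) (l : T.cocharacters) {u : G → K}
    (hu : u ∈ G.coordRing) : (fun c => u (l.1 c)) ∈ laurentRingOne K := by
  induction hu using Algebra.adjoin_induction with
  | mem u hu =>
    rcases hu with ⟨i, j, rfl⟩ | ⟨i, j, rfl⟩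
    · exact l.2 i j
    · have h := laurentRingOne_inv (l.2 i j)
      simpa using h
  | algebraMap r => exact Subalgebra.algebraMap_mem _ r
  | add f g _ _ hf hg => exact add_mem hf hg
  | mul f g _ _ hf hg => exact mul_mem hf hg

/-- The map `Y(T) → Y(S)`, `l ↦ f ∘ l`, induced by `f`. -/
def pushforward {T : MaximalTorus G} {S : MaximalTorus H} (f : Hom G H)
    (h : ∀ t : T, f t ∈ S.toSubgroup) (l : T.cocharacters) : S.cocharacters :=
  ⟨(restrict f h).comp l.1, fun i j => laurentRingOne_comp T l (f.regular i j)⟩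

/-! ### Roots and coroots -/

/-- The roots of `G` relative to `T`: the non-trivial weights of `T` on the Lie algebra. -/
def roots (T : MaximalTorus G) : Set T.characters :=
  {α | α ≠ 1 ∧ ∃ A ∈ G.lieAlg, A ≠ 0 ∧
    ∀ t : T, mat (t : G) * A * mat (t : G)⁻¹ = (α.1 t : K) • A}

/-- The matrix with rows `(1, x)`, `(0, 1)`. -/
def upper (x : K) : SL(2, K) := ⟨!![1, x; 0, 1], by simp [Matrix.det_fin_two]⟩

/-- The matrix with rows `(1, 0)`, `(x, 1)`. -/
def lower (x : K) : SL(2, K) := ⟨!![1, 0; x, 1], by simp [Matrix.det_fin_two]⟩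

/-- The diagonal matrix with entries `c`, `c⁻¹`. -/
def diag (c : Kˣ) : SL(2, K) := ⟨!![(c : K), 0; 0, ((c⁻¹ : Kˣ) : K)], by
  simp [Matrix.det_fin_two]⟩

/-- `l` is the coroot of the root `α`: there is a homomorphism of algebraic groups
`φ : SL₂ → G` mapping the upper and lower unitriangular subgroups to the root subgroups of `α`
and `-α`, such that `l(c) = φ(diag(c, c⁻¹))`. -/
def IsCoroot (T : MaximalTorus G) (α : T.characters) (l : T.cocharacters) : Prop :=
  α ∈ T.roots ∧ ∃ φ : SL(2, K) →* G,
    (∀ i j, (fun x => mat (φ x) i j) ∈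
      Algebra.adjoin K {f : SL(2, K) → K | ∃ k m, f = fun x : SL(2, K) => (x : Matrix (Fin 2) (Fin 2) K) k m}) ∧
    (∀ x, φ (upper x) = 1 → x = 0) ∧
    (∀ (t : T) (x : K), (t : G) * φ (upper x) * (t : G)⁻¹ = φ (upper ((α.1 t : K) * x))) ∧
    (∀ (t : T) (x : K),
      (t : G) * φ (lower x) * (t : G)⁻¹ = φ (lower ((((α.1 t)⁻¹ : Kˣ) : K) * x))) ∧
    (∀ c : Kˣ, φ (diag c) = (l.1 c : G))

/-- The set of coroots. -/
def coroots (T : MaximalTorus G) : Set T.cocharacters := {l | ∃ α, T.IsCoroot α l}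

end MaximalTorus

/-! ### Simply connected covers and duality -/

open MaximalTorus

/-- `δ : G_sc → G` is a simply connected cover, relative to maximal tori `Tsc` and `T`:
`G_sc` is connected reductive, `Y(Tsc)` is spanned by the coroots (`G_sc` is semisimple and
simply connected), and `δ` is a central isogeny, that is an isogeny with `δ(Tsc) = T` that
induces bijections between the roots and between the coroots of the two groups. -/
structure IsSimplyConnectedCover {Gsc G : LinearAlgebraicGroup K} (Tsc : MaximalTorus Gsc)
    (T : MaximalTorus G) (δ : Hom Gsc G) : Prop where
  reductive : Gsc.IsReductive
  simplyConnected : Subgroup.closure Tsc.coroots = ⊤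
  isogeny : δ.IsIsogeny
  mapsTo : ∀ t : Tsc, δ t ∈ T.toSubgroup
  surjOn : ∀ t : T, ∃ s : Tsc, δ s = t
  roots_bijOn : Set.BijOn (pullback δ mapsTo) T.roots Tsc.roots
  coroots_bijOn : Set.BijOn (pushforward δ mapsTo) Tsc.coroots T.coroots
  coroot_iff : ∀ (α : T.characters) (l : Tsc.cocharacters),
    Tsc.IsCoroot (pullback δ mapsTo α) l ↔ T.IsCoroot α (pushforward δ mapsTo l)

/-- The triples `(G, T, F)` and `(Gd, Td, Fd)` are in duality: `T` is `F`-stable, `Td` is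
`Fd`-stable, and there are an isomorphism `φ : X(T) ≃ Y(Td)` and its transpose
`ψ : X(Td) ≃ Y(T)` which carry roots to coroots compatibly with `α ↔ α^∨`, such that
`φ (χ ∘ F) = Fd ∘ φ χ` for all `χ`. -/
def InDuality {G Gd : LinearAlgebraicGroup K} (T : MaximalTorus G) (F : Hom G G)
    (Td : MaximalTorus Gd) (Fd : Hom Gd Gd) : Prop :=
  ∃ (hF : ∀ t : T, F t ∈ T.toSubgroup) (hFd : ∀ t : Td, Fd t ∈ Td.toSubgroup)
    (φ : T.characters ≃* Td.cocharacters) (ψ : Td.characters ≃* T.cocharacters),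
    (∀ (χ : T.characters) (η : Td.characters) (c : Kˣ),
      χ.1 ((ψ η).1 c) = η.1 ((φ χ).1 c)) ∧
    Set.BijOn φ T.roots Td.coroots ∧
    Set.BijOn ψ Td.roots T.coroots ∧
    (∀ (α : T.characters) (β : Td.characters), T.IsCoroot α (ψ β) ↔ Td.IsCoroot β (φ α)) ∧
    (∀ χ : T.characters, φ (pullback F hF χ) = pushforward Fd hFd (φ χ))

end LinearAlgebraicGroup

end AlgebraicGroups

namespace LinearAlgebraicGroup

open MaximalTorus

/-! ### Regular homomorphisms between split tori are monomial -/

/-! Let Q be the image of Y(T_sc) in Y(T), that is, the lattice spanned by the coroots. Both sides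
of (a) are read off from the finite group Y(T)/Q.

The centre of the dual group is the intersection of the kernels of the roots in its torus
(`MaximalTorus.mem_center_iff`). A point of a torus is the same as a homomorphism from the character
group to Kˣ. Transporting along ψ : X(T*) ≃ Y(T), which takes roots to coroots, makes Z(G*) the
group of homomorphisms Y(T)/Q → Kˣ.

On the other side, Ker δ is finite and normal in a connected group, hence central and contained in
T_sc. Evaluating cocharacters at roots of unity of order prime to p identifies it with the
prime-to-p part of Y(T)/Q (`IsSimplyConnectedCover.exists_cocharacters_to_ker`). As Kˣ has no
p-torsion, homomorphisms to Kˣ only see that part. Hence Z(G*) ≅ Hom(Ker δ, Kˣ), compatibly with the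
Frobenius maps (`IsSimplyConnectedCover.exists_center_mulEquiv`).

For (a), an endomorphism of a finite abelian group and its dual have equally many fixed points
(`card_fixed_characters`). For (b), the roles are exchanged: Z(G) ≅ Hom(Ker δ*, Kˣ). When these
groups are cyclic, both Frobenius maps are the power map with one common exponent, and subgroups of
equal order are isomorphic.

The geometric input is that an element of T on which all roots are trivial is central: it acts
trivially on the Lie algebra and has order prime to p, so Krull's intersection theorem makes it
centralise a neighbourhood of 1, hence all of the connected group. -/

theorem mem_closure_of_mem_adjoin_monoidHom {K M : Type*} [Field K] [Monoid M] {S : Set (M →* K)}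
    {χ : M →* K} (h : (χ : M → K) ∈ Algebra.adjoin K ((fun f : M →* K => (f : M → K)) '' S)) :
    χ ∈ Submonoid.closure S := by
  let c : (M →* K) →* (M → K) := { toFun := fun f => f, map_one' := rfl, map_mul' := fun _ _ => rfl }
  have h1 : (χ : M → K) ∈ Submodule.span K (c '' (Submonoid.closure S : Set (M →* K))) := by
    have h2 := (Subalgebra.mem_toSubmodule _).2 h
    rw [Algebra.adjoin_eq_span] at h2
    have h3 : ((Submonoid.closure ((fun f : M →* K => (f : M → K)) '' S) : Submonoid (M → K)) :
        Set (M → K)) = c '' (Submonoid.closure S : Set (M →* K)) := by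
      rw [← Submonoid.coe_map, MonoidHom.map_mclosure]
      rfl
    rwa [h3] at h2
  -- Dedekind: distinct characters are linearly independent, so a character in the span of a set of
  -- characters already belongs to that set.
  by_contra hχ
  exact (linearIndependent_monoidHom M K).notMem_span_image hχ h1

theorem exists_zpow_of_mem_laurentRing {K : Type*} [Field K] {r : ℕ} {χ : (Fin r → Kˣ) →* Kˣ}
    (h : (fun c => (χ c : K)) ∈ laurentRing K r) :
    ∃ k : Fin r → ℤ, ∀ c, χ c = ∏ i, c i ^ k i := by
  let co : Fin r → ((Fin r → Kˣ) →* K) := fun i =>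
    (Units.coeHom K).comp (Pi.evalMonoidHom (fun _ => Kˣ) i)
  let ci : Fin r → ((Fin r → Kˣ) →* K) := fun i =>
    (Units.coeHom K).comp ((Pi.evalMonoidHom (fun _ => Kˣ) i)⁻¹)
  have h1 : (Units.coeHom K).comp χ ∈ Submonoid.closure (Set.range co ∪ Set.range ci) := by
    apply mem_closure_of_mem_adjoin_monoidHom
    refine Algebra.adjoin_mono ?_ h
    rintro f (⟨i, rfl⟩ | ⟨i, rfl⟩)
    · exact ⟨co i, Or.inl ⟨i, rfl⟩, rfl⟩
    · exact ⟨ci i, Or.inr ⟨i, rfl⟩, rfl⟩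
  have h2 : ∃ k : Fin r → ℤ, ∀ c, (Units.coeHom K).comp χ c = ((∏ i, c i ^ k i : Kˣ) : K) := by
    generalize (Units.coeHom K).comp χ = ω at h1
    induction h1 using Submonoid.closure_induction with
    | mem f hf =>
      rcases hf with ⟨i, rfl⟩ | ⟨i, rfl⟩
      · refine ⟨Pi.single i 1, fun c => ?_⟩
        rw [Finset.prod_eq_single i (by intro j _ hj; simp [hj]) (by simp)]
        simp [co]
      · refine ⟨Pi.single i (-1), fun c => ?_⟩
        rw [Finset.prod_eq_single i (by intro j _ hj; simp [hj]) (by simp)]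
        simp [ci]
    | one => exact ⟨0, fun c => by simp⟩
    | mul f g _ _ hf hg =>
      obtain ⟨k, hk⟩ := hf
      obtain ⟨l, hl⟩ := hg
      refine ⟨k + l, fun c => ?_⟩
      simp only [MonoidHom.mul_apply, hk, hl, Pi.add_apply, zpow_add, Finset.prod_mul_distrib,
        Units.val_mul]
  obtain ⟨k, hk⟩ := h2
  exact ⟨k, fun c => Units.ext (hk c)⟩

theorem exists_zpow_of_mem_laurentRingOne {K : Type*} [Field K] {χ : Kˣ →* Kˣ}
    (h : (fun c => (χ c : K)) ∈ laurentRingOne K) : ∃ k : ℤ, ∀ c, χ c = c ^ k := by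
  have h1 : (Units.coeHom K).comp χ ∈
      Submonoid.closure {Units.coeHom K, (Units.coeHom K).comp (MonoidHom.id Kˣ)⁻¹} := by
    apply mem_closure_of_mem_adjoin_monoidHom
    refine Algebra.adjoin_mono ?_ h
    rintro f (rfl | rfl)
    · exact ⟨_, Or.inl rfl, rfl⟩
    · exact ⟨_, Or.inr rfl, rfl⟩
  have h2 : ∃ k : ℤ, ∀ c, (Units.coeHom K).comp χ c = ((c ^ k : Kˣ) : K) := by
    generalize (Units.coeHom K).comp χ = ω at h1
    induction h1 using Submonoid.closure_induction with
    | mem f hf =>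
      rcases hf with rfl | rfl
      · exact ⟨1, fun c => by simp⟩
      · exact ⟨-1, fun c => by simp⟩
    | one => exact ⟨0, fun c => by simp⟩
    | mul f g _ _ hf hg =>
      obtain ⟨k, hk⟩ := hf
      obtain ⟨l, hl⟩ := hg
      exact ⟨k + l, fun c => by simp only [MonoidHom.mul_apply, hk, hl, zpow_add, Units.val_mul]⟩
  obtain ⟨k, hk⟩ := h2
  exact ⟨k, fun c => Units.ext (hk c)⟩

theorem zpow_mem_laurentRingOne {K : Type*} [Field K] (k : ℤ) :
    (fun c : Kˣ => ((c ^ k : Kˣ) : K)) ∈ laurentRingOne K := by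
  rcases k with k | k
  · have h : (fun c : Kˣ => ((c ^ (Int.ofNat k) : Kˣ) : K)) = (fun c : Kˣ => (c : K)) ^ k := by
      funext c; simp
    rw [h]
    have h0 : (fun c : Kˣ => (c : K)) ∈ laurentRingOne K := Algebra.subset_adjoin (Or.inl rfl)
    exact pow_mem h0 k
  · have h : (fun c : Kˣ => ((c ^ (Int.negSucc k) : Kˣ) : K)) =
        (fun c : Kˣ => ((c⁻¹ : Kˣ) : K)) ^ (k + 1) := by
      funext c; simp [zpow_negSucc]
    rw [h]
    have h0 : (fun c : Kˣ => ((c⁻¹ : Kˣ) : K)) ∈ laurentRingOne K :=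
      Algebra.subset_adjoin (Or.inr rfl)
    exact pow_mem h0 (k + 1)

theorem laurentRing_comp_zpow {K : Type*} [Field K] {r : ℕ} (k : Fin r → ℤ)
    {u : (Fin r → Kˣ) → K} (hu : u ∈ laurentRing K r) :
    (fun c : Kˣ => u (fun i => c ^ k i)) ∈ laurentRingOne K := by
  induction hu using Algebra.adjoin_induction with
  | mem u hu =>
    rcases hu with ⟨i, rfl⟩ | ⟨i, rfl⟩
    · exact zpow_mem_laurentRingOne (k i)
    · simpa only [zpow_neg] using zpow_mem_laurentRingOne (K := K) (-k i)
  | algebraMap r => exact Subalgebra.algebraMap_mem _ r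
  | add f g _ _ hf hg => exact add_mem hf hg
  | mul f g _ _ hf hg => exact mul_mem hf hg

theorem mem_laurentRing_comp {K : Type*} [Field K] {G : LinearAlgebraicGroup K} {r : ℕ}
    {e : (Fin r → Kˣ) → G} (he : ∀ i j, (fun c => mat (e c) i j) ∈ laurentRing K r)
    (he' : ∀ i j, (fun c => mat (e c)⁻¹ i j) ∈ laurentRing K r)
    {u : G → K} (hu : u ∈ G.coordRing) : (fun c => u (e c)) ∈ laurentRing K r := by
  induction hu using Algebra.adjoin_induction with
  | mem u hu =>
    rcases hu with ⟨i, j, rfl⟩ | ⟨i, j, rfl⟩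
    · exact he i j
    · exact he' i j
  | algebraMap r => exact Subalgebra.algebraMap_mem _ r
  | add f g _ _ hf hg => exact add_mem hf hg
  | mul f g _ _ hf hg => exact mul_mem hf hg

theorem laurentRing_inv {K : Type*} [Field K] {r : ℕ} {f : (Fin r → Kˣ) → K}
    (hf : f ∈ laurentRing K r) : (fun c => f c⁻¹) ∈ laurentRing K r := by
  induction hf using Algebra.adjoin_induction with
  | mem f hf =>
    rcases hf with ⟨i, rfl⟩ | ⟨i, rfl⟩
    · exact Algebra.subset_adjoin (Or.inr ⟨i, rfl⟩)
    · exact Algebra.subset_adjoin (Or.inl ⟨i, by simp⟩)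
  | algebraMap r => exact Subalgebra.algebraMap_mem _ r
  | add f g _ _ hf hg => exact add_mem hf hg
  | mul f g _ _ hf hg => exact mul_mem hf hg

/-- The one-parameter subgroup `z ↦ e (z ^ k₁, …, z ^ kᵣ)`. -/
def monomialHom {K M : Type*} [Field K] [Group M] {r : ℕ} (e : (Fin r → Kˣ) ≃* M)
    (k : Fin r → ℤ) : Kˣ →* M where
  toFun z := e fun i => z ^ k i
  map_one' := by simp only [one_zpow]; exact e.map_one
  map_mul' a b := by simp only [mul_zpow]; exact e.map_mul (fun i => a ^ k i) fun i => b ^ k i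

@[simp] theorem monomialHom_apply {K M : Type*} [Field K] [Group M] {r : ℕ}
    (e : (Fin r → Kˣ) ≃* M) (k : Fin r → ℤ) (z : Kˣ) :
    monomialHom e k z = e fun i => z ^ k i := rfl

/-- Coordinates on a torus, describing its characters and cocharacters. -/
theorem MaximalTorus.exists_coordinates {K : Type*} [Field K] {G : LinearAlgebraicGroup K}
    (T : MaximalTorus G) : ∃ (r : ℕ) (e : (Fin r → Kˣ) ≃* T),
      (∀ i, (Pi.evalMonoidHom (fun _ => Kˣ) i).comp e.symm.toMonoidHom ∈ T.characters) ∧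
      (∀ χ ∈ T.characters, ∃ k : Fin r → ℤ, ∀ t, χ t = ∏ i, e.symm t i ^ k i) ∧
      (∀ k : Fin r → ℤ, monomialHom e k ∈ T.cocharacters) ∧
      (∀ l ∈ T.cocharacters, ∃ k : Fin r → ℤ, l = monomialHom e k) := by
  obtain ⟨-, r, e, he, hs⟩ := T.isTorus
  refine ⟨r, e, hs, ?_, ?_, ?_⟩
  · rintro χ ⟨f, hf, hχ⟩
    have h : (fun c => ((χ.comp e.toMonoidHom) c : K)) ∈ laurentRing K r := by
      have h1 := mem_laurentRing_comp (e := fun c => (e c : G)) he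
        (fun i j => by simpa using laurentRing_inv (he i j)) hf
      convert h1 using 2 with c
      exact hχ (e c)
    obtain ⟨k, hk⟩ := exists_zpow_of_mem_laurentRing h
    refine ⟨k, fun t => ?_⟩
    rw [← hk]
    simp
  · exact fun k i j => laurentRing_comp_zpow k (he i j)
  · intro l hl
    have h : ∀ i, ∃ k : ℤ, ∀ c, e.symm (l c) i = c ^ k := by
      intro i
      obtain ⟨f, hf, hfe⟩ := hs i
      have h1 := laurentRingOne_comp T ⟨l, hl⟩ hf
      have h2 : (fun c => ((((Pi.evalMonoidHom (fun _ => Kˣ) i).comp e.symm.toMonoidHom).comp l) c : K))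
          ∈ laurentRingOne K := by
        convert h1 using 2 with c
        exact hfe (l c)
      exact exists_zpow_of_mem_laurentRingOne h2
    choose k hk using h
    refine ⟨k, MonoidHom.ext fun c => ?_⟩
    rw [monomialHom_apply, ← e.symm_apply_eq]
    funext i
    exact hk i c

/-! ### Points of tori over an algebraically closed field whose units are torsion -/

/-- A unit lies in a finite subfield L, and |L| - 1 equals -1 in K. Thus all torsion is prime to p,
which is what makes elements of tori semisimple and `Kˣ` free of p-torsion. -/
theorem exists_pow_eq_one_of_isAlgebraic (p : ℕ) [Fact p.Prime] {K : Type*} [Field K]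
    [Algebra (ZMod p) K] [Algebra.IsAlgebraic (ZMod p) K] (x : Kˣ) :
    ∃ m : ℕ, (m : K) ≠ 0 ∧ x ^ m = 1 := by
  have hx : IsIntegral (ZMod p) (x : K) := Algebra.IsIntegral.isIntegral _
  let L := IntermediateField.adjoin (ZMod p) {(x : K)}
  have : FiniteDimensional (ZMod p) L := IntermediateField.adjoin.finiteDimensional hx
  have : Finite L := Module.finite_of_finite (ZMod p)
  have : Fintype L := Fintype.ofFinite L
  let y : L := ⟨x, IntermediateField.mem_adjoin_simple_self _ _⟩
  have hy : y ≠ 0 := fun h => x.ne_zero (congrArg Subtype.val h)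
  refine ⟨Fintype.card L - 1, ?_, ?_⟩
  · rw [Nat.cast_sub Fintype.card_pos]
    have h : ((Fintype.card L : ℕ) : L) = 0 := Nat.cast_card_eq_zero L
    have h' : ((Fintype.card L : ℕ) : K) = 0 := by
      rw [← map_natCast (algebraMap L K), h, map_zero]
    simp [h']
  · have h := FiniteField.pow_card_sub_one_eq_one y hy
    ext
    have := congrArg (fun z : L => (z : K)) h
    simpa [y] using this

theorem exists_unit_isPrimitiveRoot {K : Type*} [Field K] [IsAlgClosed K] {N : ℕ}
    (hN : (N : K) ≠ 0) : ∃ ζ : Kˣ, IsPrimitiveRoot ζ N := by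
  have : NeZero (N : K) := ⟨hN⟩
  have : NeZero N := ⟨fun h => hN (by simp [h])⟩
  obtain ⟨ζ, hζ⟩ := HasEnoughRootsOfUnity.exists_primitiveRoot K N
  exact ⟨(hζ.isUnit (NeZero.ne N)).unit, IsPrimitiveRoot.coe_units_iff.1 hζ⟩

theorem eq_zero_of_forall_zpow_eq_one {K : Type*} [Field K] [IsAlgClosed K] {k : ℤ}
    (h : ∀ z : Kˣ, z ^ k = 1) : k = 0 := by
  -- Of two consecutive integers at least one is nonzero in K, so a primitive root of unity of order
  -- exceeding |k| exists.
  obtain ⟨N, hN, hNK⟩ : ∃ N : ℕ, k.natAbs < N ∧ (N : K) ≠ 0 := by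
    by_cases h1 : ((k.natAbs + 1 : ℕ) : K) = 0
    · refine ⟨k.natAbs + 2, by omega, fun h2 => one_ne_zero (α := K) ?_⟩
      push_cast at h1 h2
      linear_combination h2 - h1
    · exact ⟨_, by omega, h1⟩
  obtain ⟨ζ, hζ⟩ := exists_unit_isPrimitiveRoot hNK
  exact Int.eq_zero_of_dvd_of_natAbs_lt_natAbs ((hζ.zpow_eq_one_iff_dvd k).1 (h ζ)) (by simpa)

/-! ### Evaluation of characters and cocharacters, and surjections of tori. -/

section

variable {K : Type*} [Field K] {G : LinearAlgebraicGroup K}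

theorem MaximalTorus.exists_pow_eq_one (hK : ∀ x : Kˣ, ∃ m : ℕ, (m : K) ≠ 0 ∧ x ^ m = 1)
    (T : MaximalTorus G) (t : T) : ∃ m : ℕ, (m : K) ≠ 0 ∧ t ^ m = 1 := by
  obtain ⟨r, e, -⟩ := T.exists_coordinates
  choose m hm hm' using fun i => hK (e.symm t i)
  refine ⟨∏ i, m i, by simpa [Finset.prod_eq_zero_iff] using hm, ?_⟩
  apply e.symm.injective
  rw [map_pow, map_one]
  funext i
  obtain ⟨c, hc⟩ := Finset.dvd_prod_of_mem m (Finset.mem_univ i)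
  rw [Pi.pow_apply, hc, pow_mul, hm', one_pow, Pi.one_apply]

/-- In coordinates, z ↦ z ^ k is trivial at ζ exactly when N divides k. With the next lemma,
evaluation at ζ identifies Y/NY with the N-torsion of T. -/
theorem MaximalTorus.exists_pow_eq_cocharacter (T : MaximalTorus G) {N : ℕ} {ζ : Kˣ}
    (hζ : IsPrimitiveRoot ζ N) (y : T.cocharacters) (hy : y.1 ζ = 1) :
    ∃ w : T.cocharacters, y = w ^ N := by
  obtain ⟨r, e, -, -, h3, h4⟩ := T.exists_coordinates
  obtain ⟨k, hk⟩ := h4 y.1 y.2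
  have h : ∀ i, (N : ℤ) ∣ k i := by
    intro i
    rw [hk, monomialHom_apply, EmbeddingLike.map_eq_one_iff] at hy
    exact (hζ.zpow_eq_one_iff_dvd _).1 (congrFun hy i)
  choose l hl using h
  refine ⟨⟨_, h3 l⟩, Subtype.ext ?_⟩
  rw [hk]
  ext z : 1
  change e _ = (e _) ^ N
  rw [← map_pow]
  congr 1
  funext i
  rw [Pi.pow_apply, hl, mul_comm, zpow_mul, zpow_natCast]

theorem MaximalTorus.exists_cocharacter_apply_eq (T : MaximalTorus G) {N : ℕ} (hN : N ≠ 0)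
    {ζ : Kˣ} (hζ : IsPrimitiveRoot ζ N) (t : T) (ht : t ^ N = 1) :
    ∃ w : T.cocharacters, w.1 ζ = t := by
  obtain ⟨r, e, -, -, h3, -⟩ := T.exists_coordinates
  have : NeZero N := ⟨hN⟩
  have h : ∀ i, ∃ k : ℤ, ζ ^ k = e.symm t i := by
    intro i
    have h1 : (e.symm t i) ^ N = 1 := by
      have := congrFun (congrArg e.symm ht) i
      simpa using this
    obtain ⟨j, -, hj⟩ := (IsPrimitiveRoot.coe_units_iff.2 hζ).eq_pow_of_pow_eq_one
      (ξ := ((e.symm t i : Kˣ) : K)) (by rw [← Units.val_pow_eq_pow_val, h1, Units.val_one])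
    refine ⟨j, Units.ext ?_⟩
    simpa using hj
  choose k hk using h
  exact ⟨⟨_, h3 k⟩, by simp [monomialHom_apply, hk]⟩

theorem MaximalTorus.cocharacter_pow_injective [IsAlgClosed K] (T : MaximalTorus G) {N : ℕ}
    (hN : N ≠ 0) {y w : T.cocharacters} (h : y ^ N = w ^ N) : y = w := by
  obtain ⟨r, e, -, -, -, h4⟩ := T.exists_coordinates
  obtain ⟨k, hk⟩ := h4 y.1 y.2
  obtain ⟨l, hl⟩ := h4 w.1 w.2
  have : k = l := by
    funext i
    have h1 : ∀ z : Kˣ, z ^ (N * (k i - l i)) = 1 := by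
      intro z
      have h2 : (y.1 z) ^ N = (w.1 z) ^ N := DFunLike.congr_fun (congrArg Subtype.val h) z
      rw [hk, hl, monomialHom_apply, monomialHom_apply, ← map_pow, ← map_pow] at h2
      have h3 := congrFun (e.injective h2) i
      simp only [Pi.pow_apply] at h3
      rw [mul_comm, zpow_mul, zpow_sub, zpow_natCast, mul_pow, h3, inv_pow, mul_inv_cancel]
    have h2 := eq_zero_of_forall_zpow_eq_one h1
    rcases mul_eq_zero.1 h2 with h3 | h3
    · exact absurd (by exact_mod_cast h3) hN
    · linarith
  exact Subtype.ext (by rw [hk, hl, this])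

theorem MaximalTorus.eq_of_forall_character (T : MaximalTorus G) {s t : T}
    (h : ∀ χ : T.characters, χ.1 s = χ.1 t) : s = t := by
  obtain ⟨r, e, h1, -⟩ := T.exists_coordinates
  apply e.symm.injective
  funext i
  exact h ⟨_, h1 i⟩

/-- Every character is a monomial in the coordinate characters, so a homomorphism on X(T) is
determined by its values there, and these can be taken as the coordinates of a point. -/
theorem MaximalTorus.exists_forall_character_eq (T : MaximalTorus G) (f : T.characters →* Kˣ) :
    ∃ t : T, ∀ χ : T.characters, χ.1 t = f χ := by
  obtain ⟨r, e, h1, h2, -⟩ := T.exists_coordinates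
  let c : Fin r → T.characters := fun i => ⟨_, h1 i⟩
  refine ⟨e fun i => f (c i), fun χ => ?_⟩
  obtain ⟨k, hk⟩ := h2 χ.1 χ.2
  have h3 : χ = ∏ i, c i ^ k i := by
    apply Subtype.ext
    ext t : 1
    rw [hk]
    simp [c]
  rw [hk]
  conv_rhs => rw [h3, map_prod]
  simp

/-- A surjection of tori has a cokernel of finite exponent on cocharacters. -/
theorem MaximalTorus.exists_pow_mem_pushforward [IsAlgClosed K] {H : LinearAlgebraicGroup K}
    {T : MaximalTorus G} {S : MaximalTorus H} (f : Hom G H) (h : ∀ t : T, f t ∈ S.toSubgroup)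
    (hs : ∀ s : S, ∃ t : T, f t = s) :
    ∃ n : ℕ, n ≠ 0 ∧ ∀ y : S.cocharacters, ∃ w : T.cocharacters, pushforward f h w = y ^ n := by
  obtain ⟨r, e, -, -, h3, -⟩ := T.exists_coordinates
  obtain ⟨s, e', -, -, h3', h4'⟩ := S.exists_coordinates
  let Y : (Fin s → ℤ) → S.cocharacters := fun k => ⟨_, h3' k⟩
  have Yadd : ∀ k l, Y (k + l) = Y k * Y l := by
    intro k l
    apply Subtype.ext
    ext z : 1
    change e' _ = e' _ * e' _
    rw [← map_mul]
    congr 1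
    funext i
    simp [zpow_add]
  have Ysmul : ∀ (n : ℕ) k, Y (n • k) = Y k ^ n := by
    intro n k
    induction n with
    | zero =>
      rw [zero_smul, pow_zero]
      have := Yadd 0 0
      rw [add_zero] at this
      exact left_eq_mul.1 this
    | succ n ih => rw [succ_nsmul, Yadd, ih, pow_succ]
  have push_mul : ∀ a b, pushforward f h (a * b) = pushforward f h a * pushforward f h b := by
    intro a b
    apply Subtype.ext
    exact MonoidHom.comp_mul _ _ _
  have push_inv : ∀ a, pushforward f h a⁻¹ = (pushforward f h a)⁻¹ := by
    intro a
    apply Subtype.ext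
    exact MonoidHom.comp_inv _ _
  let Λ : AddSubgroup (Fin s → ℤ) :=
    { carrier := {k | ∃ w, pushforward f h w = Y k}
      zero_mem' := ⟨1, by
        have h1 := push_mul 1 1
        have h2 := Yadd 0 0
        rw [mul_one, left_eq_mul] at h1
        rw [add_zero, left_eq_mul] at h2
        rw [h1, h2]⟩
      add_mem' := by
        rintro k l ⟨w, hw⟩ ⟨v, hv⟩
        exact ⟨w * v, by rw [push_mul, hw, hv, Yadd]⟩
      neg_mem' := by
        rintro k ⟨w, hw⟩
        refine ⟨w⁻¹, ?_⟩
        rw [push_inv, hw, inv_eq_iff_mul_eq_one, ← Yadd, add_neg_cancel]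
        have h2 := Yadd 0 0
        rwa [add_zero, left_eq_mul] at h2 }
  let Λ' : Submodule ℤ (Fin s → ℤ) := AddSubgroup.toIntSubmodule Λ
  -- A linear form vanishing on the image lattice is a character of S that is trivial on every
  -- pushed-forward cocharacter; surjectivity of f will force it to vanish.
  have key : ∀ φ : (Fin s → ℤ) →ₗ[ℤ] ℤ, (∀ k ∈ Λ', φ k = 0) → φ = 0 := by
    intro φ hφ
    let v : Fin s → ℤ := fun i => φ (Pi.single i 1)
    have hv : ∀ k, φ k = ∑ i, k i * v i := by
      intro k
      conv_lhs => rw [← Finset.univ_sum_single k, map_sum]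
      refine Finset.sum_congr rfl fun i _ => ?_
      have : Pi.single i (k i) = k i • (Pi.single i 1 : Fin s → ℤ) := by
        rw [← Pi.single_smul]; simp
      rw [this, map_smul, smul_eq_mul]
    have char : ∀ (k : Fin s → ℤ) (z : Kˣ),
        ∏ i, e'.symm ((Y k).1 z) i ^ v i = z ^ φ k := by
      intro k z
      have : e'.symm ((Y k).1 z) = fun i => z ^ k i := e'.symm_apply_apply _
      have hsum : z ^ (∑ i, k i * v i) = ∏ i, z ^ (k i * v i) := by
        induction (Finset.univ : Finset (Fin s)) using Finset.induction_on with
        | empty => simp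
        | insert i t hi ih => rw [Finset.sum_insert hi, Finset.prod_insert hi, zpow_add, ih]
      simp only [this, hv, hsum, zpow_mul]
    let Χ : S →* Kˣ :=
      { toFun := fun t => ∏ i, e'.symm t i ^ v i
        map_one' := by simp
        map_mul' := fun a b => by simp [mul_zpow, Finset.prod_mul_distrib] }
    have hpush : ∀ (w : T.cocharacters) (z : Kˣ), Χ (restrict f h (w.1 z)) = 1 := by
      intro w z
      obtain ⟨k, hk⟩ := h4' _ (pushforward f h w).2
      have hkΛ : k ∈ Λ' := ⟨w, Subtype.ext hk⟩
      have h1 := char k z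
      rw [hφ k hkΛ, zpow_zero] at h1
      have h2 : restrict f h (w.1 z) = (Y k).1 z := DFunLike.congr_fun hk z
      rw [h2]
      exact h1
    have htriv : ∀ t : S, Χ t = 1 := by
      intro t
      obtain ⟨x, hx⟩ := hs t
      have hx' : restrict f h x = t := Subtype.ext hx
      -- T is generated by the images of its coordinate one-parameter subgroups, so triviality on
      -- pushforwards gives triviality on f(T) = S.
      have hprod : x = ∏ j, monomialHom e (Pi.single j 1) (e.symm x j) := by
        apply e.symm.injective
        rw [map_prod]
        funext i
        rw [Finset.prod_apply, Finset.prod_eq_single i]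
        · simp
        · intro j _ hj
          simp [hj.symm]
        · simp
      rw [← hx', hprod, map_prod, map_prod]
      exact Finset.prod_eq_one fun j _ => hpush ⟨_, h3 _⟩ _
    ext i
    change v i = 0
    refine eq_zero_of_forall_zpow_eq_one (K := K) fun z => ?_
    have h1 := char (Pi.single i 1) z
    have h2 : φ (Pi.single i 1) = v i := rfl
    rw [← h2, ← h1]
    exact htriv _
  -- The quotient modulo torsion is finitely generated and torsion-free over ℤ, hence free, so its
  -- dual separates points. By `key` the dual is zero: the cokernel is torsion, hence finite, and
  -- its order serves as n.
  have hfin : Finite ((Fin s → ℤ) ⧸ Λ') := by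
    apply Module.finite_of_fg_torsion
    let M := (Fin s → ℤ) ⧸ Λ'
    intro x
    change x ∈ Submodule.torsion ℤ M
    rw [← Submodule.Quotient.mk_eq_zero, ← Module.forall_dual_apply_eq_zero_iff ℤ
      (Submodule.Quotient.mk x : M ⧸ Submodule.torsion ℤ M)]
    intro φ
    have h0 := key ((φ.comp (Submodule.mkQ _)).comp (Submodule.mkQ Λ')) (by
      intro k hk
      have hk0 : (Submodule.Quotient.mk k : M) = 0 := (Submodule.Quotient.mk_eq_zero Λ').2 hk
      exact (congrArg (fun m : M => φ (Submodule.Quotient.mk m)) hk0).trans (map_zero φ))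
    obtain ⟨k, rfl⟩ := Submodule.mkQ_surjective _ x
    exact LinearMap.congr_fun h0 k
  refine ⟨Nat.card ((Fin s → ℤ) ⧸ Λ'), Nat.card_pos.ne', fun y => ?_⟩
  obtain ⟨k, hk⟩ := h4' y.1 y.2
  have hy : y = Y k := Subtype.ext hk
  have h1 : Nat.card ((Fin s → ℤ) ⧸ Λ') • k ∈ Λ' := by
    rw [← Submodule.Quotient.mk_eq_zero, Submodule.Quotient.mk_smul, card_nsmul_eq_zero']
  obtain ⟨w, hw⟩ := h1
  exact ⟨w, by rw [hw, Ysmul, hy]⟩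

end

open MvPolynomial

/-! ### Polynomials on matrices, their differentials at `1`, and conjugation -/

section

variable {K : Type*} [Field K] {n : ℕ}

/-- The value of a polynomial in the matrix entries at a matrix. -/
noncomputable abbrev evalMat (A : Matrix (Fin n) (Fin n) K) : MvPolynomial (Fin n × Fin n) K →+* K :=
  MvPolynomial.eval fun ij => A ij.1 ij.2

/-- The differential at `1` of a polynomial in the matrix entries. -/
noncomputable def diffOne : MvPolynomial (Fin n × Fin n) K →ₗ[K] Module.Dual K (Matrix (Fin n) (Fin n) K) where
  toFun P :=
    { toFun := fun A => ∑ ij, evalMat 1 (pderiv ij P) * A ij.1 ij.2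
      map_add' := fun A B => by simp [mul_add, Finset.sum_add_distrib]
      map_smul' := fun c A => by simp [mul_left_comm _ c, Finset.mul_sum] }
  map_add' P Q := by ext A; simp [add_mul, Finset.sum_add_distrib]
  map_smul' c P := by
    refine LinearMap.ext fun A => ?_
    simp [smul_eval, mul_assoc, Finset.mul_sum]

theorem diffOne_apply (P : MvPolynomial (Fin n × Fin n) K) (A : Matrix (Fin n) (Fin n) K) :
    diffOne P A = ∑ ij, evalMat 1 (pderiv ij P) * A ij.1 ij.2 := rfl

theorem diffOne_mul (P Q : MvPolynomial (Fin n × Fin n) K) (A : Matrix (Fin n) (Fin n) K) :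
    diffOne (P * Q) A = evalMat 1 P * diffOne Q A + evalMat 1 Q * diffOne P A := by
  simp only [diffOne_apply, Finset.mul_sum, ← Finset.sum_add_distrib]
  refine Finset.sum_congr rfl fun ij _ => ?_
  rw [Derivation.leibniz]
  simp only [smul_eq_mul, map_add, map_mul]
  ring

@[simp] theorem diffOne_C (c : K) (A : Matrix (Fin n) (Fin n) K) : diffOne (C c) A = 0 := by
  simp [diffOne_apply]

@[simp] theorem diffOne_X (ij : Fin n × Fin n) (A : Matrix (Fin n) (Fin n) K) :
    diffOne (X ij) A = A ij.1 ij.2 := by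
  rw [diffOne_apply, Finset.sum_eq_single ij]
  · simp
  · intro kl _ h
    simp [pderiv_X_of_ne h.symm]
  · simp

/-- The maximal ideal at the identity matrix. -/
noncomputable abbrev idealAtOne (K : Type*) [Field K] (n : ℕ) : Ideal (MvPolynomial (Fin n × Fin n) K) :=
  RingHom.ker (evalMat (1 : Matrix (Fin n) (Fin n) K))

/-- First-order Taylor expansion at the identity matrix. Induction on P uses only the Leibniz rule,
so the characteristic plays no role. -/
theorem sub_taylor_mem_idealAtOne_sq (P : MvPolynomial (Fin n × Fin n) K) :
    P - C (evalMat 1 P) - ∑ ij, C (evalMat 1 (pderiv ij P)) *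
      (X ij - C ((1 : Matrix (Fin n) (Fin n) K) ij.1 ij.2)) ∈ idealAtOne K n ^ 2 := by
  have hx : ∀ ij, X ij - C ((1 : Matrix (Fin n) (Fin n) K) ij.1 ij.2) ∈ idealAtOne K n := by
    intro ij
    simp [RingHom.mem_ker]
  induction P using MvPolynomial.induction_on with
  | C a => simp
  | add P Q hP hQ =>
    convert add_mem hP hQ using 1
    simp only [map_add, add_mul, Finset.sum_add_distrib]
    ring
  | mul_X P k hP =>
    set c := (1 : Matrix (Fin n) (Fin n) K) k.1 k.2 with hc
    set L := ∑ ij, C (evalMat 1 (pderiv ij P)) *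
      (X ij - C ((1 : Matrix (Fin n) (Fin n) K) ij.1 ij.2)) with hL
    have hLm : L ∈ idealAtOne K n := sum_mem fun ij _ => Ideal.mul_mem_left _ _ (hx ij)
    have h1 : ∑ ij, C (evalMat 1 (pderiv ij (P * X k))) *
        (X ij - C ((1 : Matrix (Fin n) (Fin n) K) ij.1 ij.2)) =
        C c * L + C (evalMat 1 P) * (X k - C c) := by
      have h2 : ∀ ij, C (evalMat 1 (pderiv ij (P * X k))) *
          (X ij - C ((1 : Matrix (Fin n) (Fin n) K) ij.1 ij.2)) =
          C c * (C (evalMat 1 (pderiv ij P)) *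
            (X ij - C ((1 : Matrix (Fin n) (Fin n) K) ij.1 ij.2))) +
          (if ij = k then C (evalMat 1 P) * (X k - C c) else 0) := by
        intro ij
        rw [Derivation.leibniz]
        by_cases h : ij = k
        · subst h
          simp only [smul_eq_mul, map_add, map_mul, pderiv_X_self, eval_X, if_true, map_one, ← hc]
          ring
        · simp only [smul_eq_mul, map_add, map_mul, pderiv_X_of_ne (Ne.symm h), eval_X, if_neg h,
            map_zero, ← hc]
          ring
      rw [Finset.sum_congr rfl fun ij _ => h2 ij, Finset.sum_add_distrib, ← Finset.mul_sum]
      simp [← hL]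
    rw [h1]
    have h3 : P * X k - C (evalMat 1 (P * X k)) -
        (C c * L + C (evalMat 1 P) * (X k - C c)) =
        (P - C (evalMat 1 P) - L) * X k + L * (X k - C c) := by
      simp only [map_mul, eval_X, ← hc]
      ring
    rw [h3]
    refine add_mem (Ideal.mul_mem_right _ _ hP) ?_
    rw [pow_two]
    exact Ideal.mul_mem_mul hLm (hx k)

theorem mem_idealAtOne_sq {P : MvPolynomial (Fin n × Fin n) K} (h0 : evalMat 1 P = 0)
    (h1 : diffOne P = 0) : P ∈ idealAtOne K n ^ 2 := by
  have h := sub_taylor_mem_idealAtOne_sq P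
  have h2 : ∀ ij, evalMat 1 (pderiv ij P) = 0 := by
    rintro ⟨i, j⟩
    have h3 := LinearMap.congr_fun h1 (Matrix.single i j 1)
    rw [diffOne_apply, Finset.sum_eq_single (i, j)] at h3
    · simpa using h3
    · rintro ⟨k, l⟩ _ hkl
      rw [Matrix.single_apply_of_ne, mul_zero]
      rintro ⟨rfl, rfl⟩
      exact hkl rfl
    · simp
  simpa [h0, h2] using h

/-- Composition of polynomials with the conjugation `g ↦ t g t⁻¹`. -/
noncomputable def conjPoly (t : GL (Fin n) K) :
    MvPolynomial (Fin n × Fin n) K →ₐ[K] MvPolynomial (Fin n × Fin n) K :=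
  aeval fun ij => ∑ k, ∑ l, C ((t : Matrix (Fin n) (Fin n) K) ij.1 k *
    ((t⁻¹ : GL (Fin n) K) : Matrix (Fin n) (Fin n) K) l ij.2) * X (k, l)

theorem evalMat_conjPoly (t : GL (Fin n) K) (A : Matrix (Fin n) (Fin n) K)
    (P : MvPolynomial (Fin n × Fin n) K) : evalMat A (conjPoly t P) =
      evalMat ((t : Matrix (Fin n) (Fin n) K) * A * ((t⁻¹ : GL (Fin n) K) : Matrix _ _ K)) P := by
  induction P using MvPolynomial.induction_on with
  | C a => simp [conjPoly]
  | add P Q hP hQ => simp only [map_add, hP, hQ]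
  | mul_X P k hP =>
    rw [map_mul, map_mul, map_mul, hP]
    congr 1
    simp only [conjPoly, aeval_X, map_sum, map_mul, eval_C, eval_X, Matrix.mul_apply,
      Finset.sum_mul]
    rw [Finset.sum_comm]
    refine Finset.sum_congr rfl fun i _ => Finset.sum_congr rfl fun j _ => ?_
    ring

theorem diffOne_conjPoly (t : GL (Fin n) K) (A : Matrix (Fin n) (Fin n) K)
    (P : MvPolynomial (Fin n × Fin n) K) : diffOne (conjPoly t P) A =
      diffOne P ((t : Matrix (Fin n) (Fin n) K) * A * ((t⁻¹ : GL (Fin n) K) : Matrix _ _ K)) := by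
  have h1 : ∀ Q, evalMat 1 (conjPoly t Q) = evalMat 1 Q := by
    intro Q
    rw [evalMat_conjPoly, mul_one, ← Units.val_mul, mul_inv_cancel, Units.val_one]
  induction P using MvPolynomial.induction_on with
  | C a =>
    have : conjPoly t (C a) = C a := by simp [conjPoly]
    rw [this, diffOne_C, diffOne_C]
  | add P Q hP hQ => simp only [map_add, LinearMap.add_apply, hP, hQ]
  | mul_X P k hP =>
    rw [map_mul, diffOne_mul, diffOne_mul, hP, h1, h1]
    congr 2
    simp only [conjPoly, aeval_X, map_sum, LinearMap.sum_apply, diffOne_mul, diffOne_C, diffOne_X,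
      mul_zero, add_zero, eval_C, Matrix.mul_apply, Finset.sum_mul]
    rw [Finset.sum_comm]
    refine Finset.sum_congr rfl fun i _ => Finset.sum_congr rfl fun j _ => ?_
    ring

end

/-! ### Elements acting trivially on the Lie algebra -/

section

variable {K : Type*} [Field K]

/-- The ideal of polynomials in the matrix entries that vanish on `G`. -/
def vanishing (G : LinearAlgebraicGroup K) : Ideal (MvPolynomial (Fin G.n × Fin G.n) K) where
  carrier := {P | ∀ g : G, evalMat (mat g) P = 0}
  add_mem' hP hQ g := by rw [map_add, hP g, hQ g, add_zero]
  zero_mem' g := map_zero _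
  smul_mem' P Q hQ g := by rw [smul_eq_mul, map_mul, hQ g, mul_zero]

variable {G : LinearAlgebraicGroup K}

theorem mem_lieAlg {A : Matrix (Fin G.n) (Fin G.n) K} :
    A ∈ G.lieAlg ↔ ∀ P ∈ G.vanishing, diffOne P A = 0 := Iff.rfl

theorem mat_mul (g h : G) : mat (g * h) = mat g * mat h := rfl

theorem mat_one : mat (1 : G) = 1 := rfl

theorem mat_injective : Function.Injective (mat : G → _) := fun _ _ h =>
  Subtype.ext (Units.ext h)

theorem evalMat_conjPoly_mat (t g : G) (P : MvPolynomial (Fin G.n × Fin G.n) K) :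
    evalMat (mat g) (conjPoly t P) = evalMat (mat (t * g * t⁻¹)) P :=
  evalMat_conjPoly _ _ _

theorem conjPoly_mem_vanishing (t : G) {P : MvPolynomial (Fin G.n × Fin G.n) K}
    (hP : P ∈ G.vanishing) : conjPoly t P ∈ G.vanishing := fun g => by
  rw [evalMat_conjPoly_mat]
  exact hP _

theorem conj_mem_lieAlg (t : G) {A : Matrix (Fin G.n) (Fin G.n) K} (hA : A ∈ G.lieAlg) :
    mat t * A * mat t⁻¹ ∈ G.lieAlg := by
  rw [mem_lieAlg] at hA ⊢
  intro P hP
  have h := hA _ (conjPoly_mem_vanishing t hP)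
  rwa [diffOne_conjPoly] at h

/-- Puts the tangent space in a form to which finite-dimensional biduality applies: a differential
vanishing on the Lie algebra is the differential of a polynomial vanishing on G. -/
theorem lieAlg_eq_dualCoannihilator (G : LinearAlgebraicGroup K) :
    G.lieAlg = ((G.vanishing.restrictScalars K).map diffOne).dualCoannihilator := by
  ext A
  rw [mem_lieAlg, Submodule.mem_dualCoannihilator]
  simp [Submodule.mem_map]

/-- The relation t g = g t is linear in the entries of g, so it passes unchanged to the tangent
space. -/
theorem conj_eq_of_mem_center {t : G} (ht : t ∈ Subgroup.center G)
    {A : Matrix (Fin G.n) (Fin G.n) K} (hA : A ∈ G.lieAlg) : mat t * A * mat t⁻¹ = A := by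
  have h : mat t * A = A * mat t := by
    ext i j
    let P : MvPolynomial (Fin G.n × Fin G.n) K :=
      ∑ k, C (mat t i k) * X (k, j) - ∑ k, C (mat t k j) * X (i, k)
    have hP : P ∈ G.vanishing := by
      intro g
      have h1 : mat t * mat g = mat g * mat t := by
        rw [← mat_mul, ← mat_mul, (Subgroup.mem_center_iff.1 ht g)]
      have h2 := congrFun (congrFun h1 i) j
      simp only [Matrix.mul_apply] at h2
      simp only [P, map_sub, map_sum, map_mul, eval_C, eval_X, h2, mul_comm (mat t _ j), sub_self]
    have h3 := mem_lieAlg.1 hA P hP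
    simp only [P, map_sub, map_sum, LinearMap.sub_apply, LinearMap.sum_apply, diffOne_mul,
      diffOne_C, diffOne_X, mul_zero, add_zero, eval_C, sub_eq_zero] at h3
    simp only [Matrix.mul_apply, h3, mul_comm (mat t _ j)]
  rw [h, mul_assoc, ← mat_mul, mul_inv_cancel, mat_one, mul_one]

/-- The differential of σP - P vanishes on the Lie algebra, so by biduality it is that of some Q
vanishing on G. Subtracting Q leaves a polynomial whose value and differential at 1 are zero. -/
theorem conjPoly_sub_mem_sq {t : G}
    (ht : ∀ A ∈ G.lieAlg, mat t * A * mat t⁻¹ = A) (P : MvPolynomial (Fin G.n × Fin G.n) K) :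
    conjPoly t P - P ∈ idealAtOne K G.n ^ 2 ⊔ G.vanishing := by
  have h1 : diffOne (conjPoly t P - P) ∈ (G.vanishing.restrictScalars K).map diffOne := by
    rw [← Subspace.dualCoannihilator_dualAnnihilator_eq
      (W := (G.vanishing.restrictScalars K).map diffOne), ← lieAlg_eq_dualCoannihilator,
      Submodule.mem_dualAnnihilator]
    intro A hA
    rw [map_sub, LinearMap.sub_apply, diffOne_conjPoly]
    exact sub_eq_zero.2 (congrArg (diffOne P) (ht A hA))
  obtain ⟨Q, hQ, hQd⟩ := h1
  have hQ : Q ∈ G.vanishing := hQ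
  have h2 : conjPoly t P - P - Q ∈ idealAtOne K G.n ^ 2 := by
    apply mem_idealAtOne_sq
    · have h3 := evalMat_conjPoly_mat t 1 P
      rw [mul_one, mul_inv_cancel, mat_one] at h3
      have h4 := hQ 1
      rw [mat_one] at h4
      rw [map_sub, map_sub, h3, h4, sub_self, sub_zero]
    · rw [map_sub, hQd, sub_self]
  have h3 : conjPoly t P - P = (conjPoly t P - P - Q) + Q := by ring
  rw [h3]
  exact Submodule.add_mem_sup h2 hQ

/-- Conjugation by t is trivial on the graded pieces of the filtration by powers of the ideal at 1:
from degree one, the identity σ(PQ) - PQ = (σP - P) σQ + P (σQ - Q) carries this to products. -/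
theorem conjPoly_sub_mem_of_mem_pow {t : G}
    (ht : ∀ A ∈ G.lieAlg, mat t * A * mat t⁻¹ = A) (k : ℕ) :
    ∀ P ∈ idealAtOne K G.n ^ k, conjPoly t P - P ∈ idealAtOne K G.n ^ (k + 1) ⊔ G.vanishing := by
  set m := idealAtOne K G.n with hm
  set I := G.vanishing with hI
  have hmem : ∀ P, conjPoly (t : GL (Fin G.n) K) P - P ∈ m := by
    intro P
    have h3 := evalMat_conjPoly_mat t 1 P
    rw [mul_one, mul_inv_cancel, mat_one] at h3
    rw [hm, RingHom.mem_ker, map_sub, h3, sub_self]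
  induction k with
  | zero =>
    intro P _
    rw [zero_add, pow_one]
    exact Submodule.mem_sup_left (hmem P)
  | succ k ih =>
    intro P hP
    rw [pow_succ] at hP
    induction hP using Submodule.mul_induction_on' with
    | mem_mul_mem P hP Q hQ =>
      have h : conjPoly (t : GL (Fin G.n) K) (P * Q) - P * Q =
          (conjPoly (t : GL (Fin G.n) K) P - P) * conjPoly (t : GL (Fin G.n) K) Q +
            P * (conjPoly (t : GL (Fin G.n) K) Q - Q) := by
        rw [map_mul]; ring
      have hQ' : conjPoly (t : GL (Fin G.n) K) Q ∈ m := by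
        have := add_mem (hmem Q) hQ
        rwa [sub_add_cancel] at this
      rw [h]
      refine add_mem ?_ ?_
      · have h1 := Ideal.mul_mem_mul (ih P hP) hQ'
        rw [Ideal.sup_mul, ← pow_succ] at h1
        have h2 : m ^ (k + 1 + 1) ⊔ I * m ≤ m ^ (k + 1 + 1) ⊔ I := sup_le_sup le_rfl Ideal.mul_le_left
        exact h2 h1
      · have h1 := Ideal.mul_mem_mul hP (conjPoly_sub_mem_sq ht Q)
        rw [Ideal.mul_sup, ← pow_add] at h1
        have h2 : m ^ (k + 2) ⊔ m ^ k * I ≤ m ^ (k + 2) ⊔ I := sup_le_sup le_rfl Ideal.mul_le_right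
        exact h2 h1
    | add P _ Q _ h1 h2 =>
      have h : conjPoly (t : GL (Fin G.n) K) (P + Q) - (P + Q) =
          (conjPoly (t : GL (Fin G.n) K) P - P) + (conjPoly (t : GL (Fin G.n) K) Q - Q) := by
        rw [map_add]; ring
      rw [h]
      exact add_mem h1 h2

/-- A unipotent action of finite order invertible in K is trivial. If σ - 1 maps everything into
level k, then modulo level k + 1 one has σ^j P - P ≡ j (σP - P); taking j = m kills the left side,
and m is invertible. -/
theorem conjPoly_sub_mem_pow {t : G} (ht : ∀ A ∈ G.lieAlg, mat t * A * mat t⁻¹ = A) {m : ℕ}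
    (hm : (m : K) ≠ 0) (htm : t ^ m = 1) (k : ℕ) :
    ∀ P, conjPoly t P - P ∈ idealAtOne K G.n ^ k ⊔ G.vanishing := by
  induction k with
  | zero => intro P; simp
  | succ k ih =>
    intro P
    set σ := conjPoly (t : GL (Fin G.n) K) with hσ
    set J := idealAtOne K G.n ^ (k + 1) ⊔ G.vanishing with hJ
    have hstep : ∀ h ∈ idealAtOne K G.n ^ k ⊔ G.vanishing, σ h - h ∈ J := by
      intro h hh
      obtain ⟨u, hu, v, hv, rfl⟩ := Submodule.mem_sup.1 hh
      have h1 : σ (u + v) - (u + v) = (σ u - u) + (σ v - v) := by rw [map_add]; ring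
      rw [h1]
      exact add_mem (conjPoly_sub_mem_of_mem_pow ht k u hu)
        (Submodule.mem_sup_right (sub_mem (conjPoly_mem_vanishing t hv) hv))
    have hiter : ∀ j : ℕ, σ^[j] P - P - j • (σ P - P) ∈ J := by
      intro j
      induction j with
      | zero => simp
      | succ j ihj =>
        have hj : σ^[j] P - P ∈ idealAtOne K G.n ^ k ⊔ G.vanishing := by
          clear ihj
          induction j with
          | zero => simp
          | succ j ihj =>
            have h2 := add_mem (ih (σ^[j] P)) ihj
            rwa [Function.iterate_succ_apply', ← sub_add_sub_cancel _ (σ^[j] P) P]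
        have h2 := add_mem (hstep _ hj) ihj
        convert h2 using 1
        rw [Function.iterate_succ_apply', map_sub, succ_nsmul]
        ring
    have hvan : σ^[m] P - P ∈ G.vanishing := by
      have heval : ∀ (j : ℕ) (g : G) (Q : MvPolynomial (Fin G.n × Fin G.n) K),
          evalMat (mat g) (σ^[j] Q) = evalMat (mat (t ^ j * g * (t ^ j)⁻¹)) Q := by
        intro j
        induction j with
        | zero => intro g Q; simp
        | succ j ihj =>
          intro g Q
          rw [Function.iterate_succ_apply, ihj, hσ, evalMat_conjPoly_mat]
          congr 3
          rw [pow_succ']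
          group
      intro g
      rw [map_sub, heval, htm]
      simp
    have h3 := sub_mem (Submodule.mem_sup_right hvan : σ^[m] P - P ∈ J) (hiter m)
    rw [sub_sub_cancel] at h3
    have h4 := J.mul_mem_left (C ((m : K)⁻¹)) h3
    rwa [nsmul_eq_mul, ← mul_assoc, ← map_natCast (C : K →+* MvPolynomial (Fin G.n × Fin G.n) K),
      ← map_mul, inv_mul_cancel₀ hm, map_one, one_mul] at h4

/-- By Krull's intersection theorem, an element of order prime to the characteristic that acts
trivially on the Lie algebra centralises a neighbourhood of `1`. -/
theorem exists_forall_conj_eq {t : G} (ht : ∀ A ∈ G.lieAlg, mat t * A * mat t⁻¹ = A) {m : ℕ}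
    (hm : (m : K) ≠ 0) (htm : t ^ m = 1) (P : MvPolynomial (Fin G.n × Fin G.n) K) :
    ∃ r : MvPolynomial (Fin G.n × Fin G.n) K, evalMat 1 r = 0 ∧
      ∀ g : G, evalMat (mat g) r ≠ 1 → evalMat (mat (t * g * t⁻¹)) P = evalMat (mat g) P := by
  let R := MvPolynomial (Fin G.n × Fin G.n) K
  let x : R ⧸ G.vanishing := Ideal.Quotient.mk _ (conjPoly t P - P)
  have hx : x ∈ (⨅ i : ℕ, idealAtOne K G.n ^ i • ⊤ : Submodule R (R ⧸ G.vanishing)) := by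
    rw [Submodule.mem_iInf]
    intro k
    obtain ⟨u, hu, v, hv, huv⟩ := Submodule.mem_sup.1 (conjPoly_sub_mem_pow ht hm htm k P)
    have h1 : x = u • (1 : R ⧸ G.vanishing) := by
      have h2 : x = Ideal.Quotient.mk _ (u + v) := by rw [huv]
      rw [h2, map_add, Ideal.Quotient.eq_zero_iff_mem.2 hv, add_zero]
      exact (mul_one _).symm
    rw [h1]
    exact Submodule.smul_mem_smul hu trivial
  -- Krull: an element in all powers of the ideal is fixed by multiplication by some r in the ideal.
  -- Hence σP - P vanishes on G wherever r ≠ 1, an open set containing 1.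
  rw [Ideal.mem_iInf_smul_pow_eq_bot_iff] at hx
  obtain ⟨⟨r, hr⟩, hrx⟩ := hx
  refine ⟨r, hr, fun g hg => ?_⟩
  have h1 : r * (conjPoly t P - P) - (conjPoly t P - P) ∈ G.vanishing := by
    rw [← Ideal.Quotient.eq_zero_iff_mem, map_sub, map_mul, sub_eq_zero]
    exact hrx
  have h2 := h1 g
  rw [map_sub, map_mul, map_sub, evalMat_conjPoly_mat] at h2
  have h3 : (evalMat (mat g) r - 1) *
      (evalMat (mat (t * g * t⁻¹)) P - evalMat (mat g) P) = 0 := by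
    linear_combination h2
  exact sub_eq_zero.1 ((mul_eq_zero.1 h3).resolve_left (sub_ne_zero.2 hg))

end

attribute [local instance] zariskiTopology

/-! ### Centres of connected groups -/

section

variable {K : Type*} [Field K] {G : LinearAlgebraicGroup K}

theorem isClosed_zeroSet {n : ℕ} (I : Set (MvPolynomial (Fin n × Fin n) K)) :
    IsClosed (zeroSet I) := by
  refine ⟨?_⟩
  change (zeroSet I)ᶜᶜ ∈ {S | ∃ I, S = zeroSet I}
  exact ⟨I, compl_compl _⟩

theorem isClosed_setOf_evalMat_eq_zero (P : MvPolynomial (Fin G.n × Fin G.n) K) :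
    IsClosed {g : G | evalMat (mat g) P = 0} := by
  convert (isClosed_zeroSet {P}).preimage (continuous_subtype_val (p := (· ∈ G.toSubgroup))) using 1
  ext g
  simp [zeroSet, mat]

theorem isClosed_setOf_mul_eq_mul (c d : G) : IsClosed {g : G | g * c = d * g} := by
  have h : {g : G | g * c = d * g} = ⋂ i, ⋂ j, {g : G | evalMat (mat g)
      (∑ k, C (mat c k j) * X (i, k) - ∑ k, C (mat d i k) * X (k, j)) = 0} := by
    ext g
    simp only [Set.mem_ofPred_eq, Set.mem_iInter, map_sub, map_sum, map_mul, eval_C, eval_X,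
      sub_eq_zero]
    rw [← mat_injective.eq_iff, mat_mul, mat_mul, ← Matrix.ext_iff]
    simp only [Matrix.mul_apply, mul_comm]
  rw [h]
  exact isClosed_iInter fun i => isClosed_iInter fun j => isClosed_setOf_evalMat_eq_zero _

theorem isOpen_setOf_evalMat_mul_ne_one (h : G) (P : MvPolynomial (Fin G.n × Fin G.n) K) :
    IsOpen {g : G | evalMat (mat (h * g)) P ≠ 1} := by
  let Q : MvPolynomial (Fin G.n × Fin G.n) K :=
    aeval (fun ij => ∑ k, C (mat h ij.1 k) * X (k, ij.2)) P
  have hQ : ∀ g : G, evalMat (mat g) Q = evalMat (mat (h * g)) P := by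
    intro g
    simp only [Q]
    induction P using MvPolynomial.induction_on with
    | C a => simp
    | add P Q hP hQ => simp only [map_add, hP, hQ]
    | mul_X P k hP =>
      rw [map_mul, map_mul, map_mul, hP]
      simp [mat_mul, Matrix.mul_apply]
  have h1 : {g : G | evalMat (mat (h * g)) P ≠ 1} = {g : G | evalMat (mat g) (Q - 1) = 0}ᶜ := by
    ext g
    simp [hQ, sub_eq_zero]
  rw [h1]
  exact (isClosed_setOf_evalMat_eq_zero _).isOpen_compl

/-- The centraliser of t is closed, and it is open because it contains a neighbourhood of 1 that can
be translated to each of its points; connectedness finishes. -/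
theorem mem_center_of_conj_eq (hG : G.IsConnectedGroup) {t : G} {m : ℕ} (hm : (m : K) ≠ 0)
    (htm : t ^ m = 1) (ht : ∀ A ∈ G.lieAlg, mat t * A * mat t⁻¹ = A) :
    t ∈ Subgroup.center G := by
  have : ConnectedSpace G := hG
  let S : Set G := {g : G | g * t = t * g}
  have hS : IsClopen S := by
    refine ⟨isClosed_setOf_mul_eq_mul t t, ?_⟩
    choose r hr0 hr using fun ij : Fin G.n × Fin G.n => exists_forall_conj_eq ht hm htm (X ij)
    rw [isOpen_iff_forall_mem_open]
    intro h hh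
    refine ⟨⋂ ij, {g : G | evalMat (mat (h⁻¹ * g)) (r ij) ≠ 1}, ?_,
      isOpen_iInter_of_finite fun ij => isOpen_setOf_evalMat_mul_ne_one h⁻¹ (r ij), ?_⟩
    · intro g hg
      rw [Set.mem_iInter] at hg
      have h1 : t * (h⁻¹ * g) * t⁻¹ = h⁻¹ * g := by
        apply mat_injective
        ext i j
        simpa using hr (i, j) (h⁻¹ * g) (hg (i, j))
      have h2 : h * t = t * h := hh
      have h3 : t * h⁻¹ = h⁻¹ * t := by
        rw [mul_inv_eq_iff_eq_mul, mul_assoc, eq_inv_mul_iff_mul_eq, h2]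
      have h4 : t * (h⁻¹ * g) = h⁻¹ * g * t := mul_inv_eq_iff_eq_mul.1 h1
      rw [← mul_assoc, h3, mul_assoc, mul_assoc] at h4
      exact (mul_left_cancel h4).symm
    · rw [Set.mem_iInter]
      intro ij
      change evalMat (mat (h⁻¹ * h)) (r ij) ≠ 1
      rw [inv_mul_cancel, mat_one, hr0]
      exact zero_ne_one
  have h1 := hS.eq_univ ⟨1, by simp [S]⟩
  rw [Subgroup.mem_center_iff]
  intro g
  have h2 : g ∈ S := h1 ▸ Set.mem_univ g
  exact h2

/-- A finite normal subgroup of a connected group is central. -/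
theorem le_center_of_finite (hG : G.IsConnectedGroup) (N : Subgroup G) [N.Normal] [Finite N] :
    N ≤ Subgroup.center G := by
  have : ConnectedSpace G := hG
  intro c hc
  -- As N is normal, these finitely many closed sets partition G according to the value of g c g⁻¹;
  -- the one for c is therefore clopen, and it contains 1.
  let S : N → Set G := fun d => {g : G | g * c = d * g}
  have hcl : ∀ d, IsClosed (S d) := fun d => isClosed_setOf_mul_eq_mul c d
  have hcompl : (S ⟨c, hc⟩)ᶜ = ⋃ d : {d : N // d ≠ ⟨c, hc⟩}, S d := by
    ext g
    simp only [Set.mem_compl_iff, Set.mem_iUnion]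
    constructor
    · intro hg
      refine ⟨⟨⟨g * c * g⁻¹, ‹N.Normal›.conj_mem c hc g⟩, ?_⟩, ?_⟩
      · intro h
        apply hg
        have h1 : g * c * g⁻¹ = c := congrArg Subtype.val h
        exact mul_inv_eq_iff_eq_mul.1 h1
      · simp [S]
    · rintro ⟨⟨d, hd⟩, hg⟩ hg'
      apply hd
      have h1 : g * c = d * g := hg
      have h2 : g * c = c * g := hg'
      exact Subtype.ext (mul_right_cancel (h1.symm.trans h2))
  have hS : IsClopen (S ⟨c, hc⟩) := by
    refine ⟨hcl _, ?_⟩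
    rw [← isClosed_compl_iff, hcompl]
    exact isClosed_iUnion_of_finite fun d => hcl _
  have h1 := hS.eq_univ ⟨1, by simp [S]⟩
  rw [Subgroup.mem_center_iff]
  intro g
  have h2 : g ∈ S ⟨c, hc⟩ := h1 ▸ Set.mem_univ g
  exact h2

theorem MaximalTorus.mem_of_mem_center (T : MaximalTorus G) {z : G}
    (hz : z ∈ Subgroup.center G) : z ∈ T.toSubgroup := by
  rw [← T.centralizer_eq, Subgroup.mem_centralizer_iff]
  intro t _
  exact Subgroup.mem_center_iff.1 hz t

/-- Conjugation by `t` as an endomorphism of the Lie algebra. -/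
def lieConj (t : G) : Module.End K G.lieAlg where
  toFun A := ⟨mat t * A * mat t⁻¹, conj_mem_lieAlg t A.2⟩
  map_add' A B := Subtype.ext (by simp [mul_add, add_mul])
  map_smul' c A := Subtype.ext (by simp)

theorem lieConj_mul (s t : G) : lieConj (s * t) = lieConj s * lieConj t := by
  ext A : 2
  simp [lieConj, mat_mul, mul_assoc]

theorem lieConj_one : lieConj (1 : G) = 1 := by
  ext A : 2
  simp [lieConj, mat_one]

theorem lieConj_pow (t : G) (m : ℕ) : lieConj (t ^ m) = lieConj t ^ m := by
  induction m with
  | zero => rw [pow_zero, pow_zero, lieConj_one]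
  | succ m ih => rw [pow_succ, pow_succ, lieConj_mul, ih]

/-- The Lie algebra is the sum of the common eigenspaces of a maximal torus. -/
theorem iSup_iInf_eigenspace_lieConj [IsAlgClosed K]
    (hK : ∀ x : Kˣ, ∃ m : ℕ, (m : K) ≠ 0 ∧ x ^ m = 1) (T : MaximalTorus G) :
    ⨆ χ : T → K, ⨅ t : T, (lieConj (t : G)).eigenspace (χ t) = ⊤ := by
  have hss : ∀ t : T, (lieConj (t : G)).IsSemisimple := by
    intro t
    obtain ⟨m, hm, htm⟩ := T.exists_pow_eq_one hK t
    -- The order m of t is invertible in K, so X ^ m - 1 is separable and annihilates conjugation by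
    -- t.
    refine Module.End.isSemisimple_of_squarefree_aeval_eq_zero
      (p := (Polynomial.X ^ m - 1 : Polynomial K)) ?_ ?_
    · exact (Polynomial.separable_X_pow_sub_C (1 : K) hm one_ne_zero).squarefree
    · have h : (t : G) ^ m = 1 := congrArg Subtype.val htm
      rw [map_sub, map_pow, Polynomial.aeval_X, map_one, ← lieConj_pow, h, lieConj_one, sub_self]
  have h := Module.End.iSup_iInf_maxGenEigenspace_eq_top_of_iSup_maxGenEigenspace_eq_top_of_commute
    (fun t : T => lieConj (t : G)) (fun s t _ => by
      change lieConj (s : G) * lieConj (t : G) = lieConj (t : G) * lieConj (s : G)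
      have : (s : G) * t = t * s := congrArg Subtype.val (mul_comm s t)
      rw [← lieConj_mul, ← lieConj_mul, this])
    (fun t => Module.End.iSup_maxGenEigenspace_eq_top _)
  simpa only [(hss _).isFinitelySemisimple.maxGenEigenspace_eq_eigenspace] using h

/-- At a nonzero entry (i, j) of A the weight is (t A t⁻¹)ᵢⱼ / Aᵢⱼ, a regular function of t. -/
theorem MaximalTorus.exists_character_of_mem_eigenspace (T : MaximalTorus G) {χ : T → K}
    {A : G.lieAlg} (hA : A ≠ 0) (h : ∀ t : T, lieConj (t : G) A = χ t • A) :
    ∃ α : T.characters, ∀ t : T, (α.1 t : K) = χ t := by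
  have hmul : ∀ s t, χ (s * t) = χ s * χ t := by
    intro s t
    apply smul_left_injective K hA
    change χ (s * t) • A = (χ s * χ t) • A
    have h1 : lieConj ((s * t : T) : G) A = lieConj (s : G) (lieConj (t : G) A) := by
      rw [← Module.End.mul_apply, ← lieConj_mul]; rfl
    rw [← h, h1, h t, map_smul, h s, smul_smul, mul_comm]
  have hone : χ 1 = 1 := by
    apply smul_left_injective K hA
    change χ 1 • A = (1 : K) • A
    rw [← h, one_smul]
    change lieConj (1 : G) A = A
    rw [lieConj_one, Module.End.one_apply]
  let α : T →* Kˣ := MonoidHom.toHomUnits { toFun := χ, map_one' := hone, map_mul' := hmul }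
  have hα : ∀ t, (α t : K) = χ t := fun t => rfl
  refine ⟨⟨α, ?_⟩, hα⟩
  have hA' : (A : Matrix (Fin G.n) (Fin G.n) K) ≠ 0 := fun h => hA (Subtype.ext h)
  obtain ⟨i, j, hij⟩ : ∃ i j, (A : Matrix (Fin G.n) (Fin G.n) K) i j ≠ 0 := by
    by_contra! hc
    exact hA' (Matrix.ext hc)
  refine ⟨fun g => (mat g * A * mat g⁻¹ : Matrix (Fin G.n) (Fin G.n) K) i j * (A.1 i j)⁻¹, ?_, ?_⟩
  · have h1 : (fun g : G => (mat g * A * mat g⁻¹ : Matrix (Fin G.n) (Fin G.n) K) i j *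
        (A.1 i j)⁻¹) = ∑ l, ∑ k, (A.1 i j)⁻¹ • (A.1 k l) • ((fun g : G => mat g i k) *
          (fun g : G => mat g⁻¹ l j)) := by
      funext g
      simp only [Matrix.mul_apply, Finset.sum_mul, Finset.sum_apply, Pi.smul_apply, Pi.mul_apply,
        smul_eq_mul]
      refine Finset.sum_congr rfl fun l _ => Finset.sum_congr rfl fun k _ => ?_
      ring
    rw [h1]
    have hl : ∀ k, (fun g : G => mat g i k) ∈ G.coordRing := fun k =>
      Algebra.subset_adjoin (Or.inl ⟨i, k, rfl⟩)
    have hr : ∀ l, (fun g : G => mat g⁻¹ l j) ∈ G.coordRing := fun l =>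
      Algebra.subset_adjoin (Or.inr ⟨l, j, rfl⟩)
    exact sum_mem fun l _ => sum_mem fun k _ => Subalgebra.smul_mem _ (Subalgebra.smul_mem _
      (mul_mem (hl k) (hr l)) _) _
  · intro t
    have h2 := congrFun (congrFun (congrArg Subtype.val (h t)) i) j
    change (mat (t : G) * A * mat (t : G)⁻¹ : Matrix (Fin G.n) (Fin G.n) K) i j = χ t * A.1 i j
      at h2
    rw [hα]
    exact ((congrArg (· * (A.1 i j)⁻¹) h2).trans (mul_inv_cancel_right₀ hij _)).symm

/-- The centre of a connected group is the intersection of the kernels of the roots. -/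
theorem MaximalTorus.mem_center_iff [IsAlgClosed K] (hG : G.IsConnectedGroup)
    (hK : ∀ x : Kˣ, ∃ m : ℕ, (m : K) ≠ 0 ∧ x ^ m = 1) (T : MaximalTorus G) (t : T) :
    (t : G) ∈ Subgroup.center G ↔ ∀ α ∈ T.roots, α.1 t = 1 := by
  constructor
  · rintro ht α ⟨-, A, hA, hA0, h⟩
    have h1 := h t
    rw [conj_eq_of_mem_center ht hA] at h1
    apply Units.ext
    apply smul_left_injective K hA0
    simpa using h1.symm
  · intro ht
    obtain ⟨m, hm, htm⟩ := T.exists_pow_eq_one hK t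
    refine mem_center_of_conj_eq hG hm (congrArg Subtype.val htm) ?_
    have hle : (⊤ : Submodule K G.lieAlg) ≤ (lieConj (t : G)).eigenspace 1 := by
      rw [← iSup_iInf_eigenspace_lieConj hK T]
      -- Each nonzero weight space has either trivial weight or, by definition, a root as weight; t
      -- fixes it in both cases.
      refine iSup_le fun χ => fun A hA => ?_
      by_cases hA0 : A = 0
      · rw [hA0]; exact zero_mem _
      rw [Submodule.mem_iInf] at hA
      have hA' : ∀ s : T, lieConj (s : G) A = χ s • A := fun s =>
        Module.End.mem_eigenspace_iff.1 (hA s)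
      obtain ⟨α, hα⟩ := T.exists_character_of_mem_eigenspace hA0 hA'
      have h1 : α.1 t = 1 := by
        by_cases h1 : α = 1
        · rw [h1]; rfl
        · refine ht α ⟨h1, A.1, A.2, fun h => hA0 (Subtype.ext h), fun s => ?_⟩
          rw [hα]
          exact congrArg Subtype.val (hA' s)
      rw [Module.End.mem_eigenspace_iff, hA', ← hα, h1, Units.val_one]
    intro A hA
    have h1 := Module.End.mem_eigenspace_iff.1 (hle (show (⟨A, hA⟩ : G.lieAlg) ∈ ⊤ from trivial))
    rw [one_smul] at h1
    exact congrArg Subtype.val h1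

end

/-! ### The kernel of a simply connected cover and the centre of the dual group -/

section

variable {K : Type*} [Field K]

theorem Hom.mem_ker {G H : LinearAlgebraicGroup K} {f : Hom G H} {x : G} : x ∈ f.ker ↔ f x = 1 :=
  Iff.rfl

/-- The map induced on cocharacters, as a group homomorphism. -/
def pushforwardHom {G H : LinearAlgebraicGroup K} {T : MaximalTorus G} {S : MaximalTorus H}
    (f : Hom G H) (h : ∀ t : T, f t ∈ S.toSubgroup) : T.cocharacters →* S.cocharacters where
  toFun := pushforward f h
  map_one' := Subtype.ext (MonoidHom.comp_one _)
  map_mul' _ _ := Subtype.ext (MonoidHom.comp_mul _ _ _)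

theorem pushforwardHom_apply {G H : LinearAlgebraicGroup K} {T : MaximalTorus G}
    {S : MaximalTorus H} (f : Hom G H) (h : ∀ t : T, f t ∈ S.toSubgroup) (l : T.cocharacters)
    (z : Kˣ) : (((pushforwardHom f h l).1 z : S) : H) = f (l.1 z : G) := rfl

/-- A cocharacter with values in the finite kernel is killed by the order of that kernel, while Y(T)
is torsion-free. -/
theorem pushforwardHom_injective [IsAlgClosed K] {G H : LinearAlgebraicGroup K}
    {T : MaximalTorus G} {S : MaximalTorus H} (f : Hom G H) (h : ∀ t : T, f t ∈ S.toSubgroup)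
    [Finite f.ker] : Function.Injective (pushforwardHom f h) := by
  rw [injective_iff_map_eq_one]
  intro l hl
  refine T.cocharacter_pow_injective (N := Nat.card f.ker) Nat.card_pos.ne' ?_
  rw [one_pow]
  apply Subtype.ext
  ext z : 2
  have h1 : f (l.1 z : G) = 1 := by rw [← pushforwardHom_apply f h l z, hl]; rfl
  have h2 := congrArg Subtype.val (pow_card_eq_one' (x := (⟨_, h1⟩ : f.ker)))
  exact h2

theorem eq_one_of_pow_prime_pow_eq_one {p : ℕ} [Fact p.Prime] [CharP K p] {M : Type*} [Group M]
    {x : M} {m a : ℕ} (hm : (m : K) ≠ 0) (hx : x ^ m = 1) (ha : x ^ p ^ a = 1) : x = 1 := by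
  have h1 : Nat.Coprime m (p ^ a) := by
    refine (Nat.Coprime.pow_right a ?_)
    rw [Nat.coprime_comm, (Fact.out : p.Prime).coprime_iff_not_dvd, ← CharP.cast_eq_zero_iff K p]
    exact hm
  rw [← pow_one x, ← orderOf_dvd_iff_pow_eq_one, ← h1.gcd_eq_one]
  exact Nat.dvd_gcd (orderOf_dvd_of_pow_eq_one hx) (orderOf_dvd_of_pow_eq_one ha)

variable {Gsc G : LinearAlgebraicGroup K} {Tsc : MaximalTorus Gsc} {T : MaximalTorus G}
  {δ : Hom Gsc G}

theorem IsSimplyConnectedCover.ker_le_center (h : IsSimplyConnectedCover Tsc T δ) :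
    δ.ker ≤ Subgroup.center Gsc := by
  have : Finite δ.ker := h.isogeny.2
  have : δ.ker.Normal := MonoidHom.normal_ker _
  exact le_center_of_finite h.reductive.connected _

theorem IsSimplyConnectedCover.mem_of_map_mem (h : IsSimplyConnectedCover Tsc T δ) {x : Gsc}
    (hx : δ x ∈ T.toSubgroup) : x ∈ Tsc.toSubgroup := by
  obtain ⟨s, hs⟩ := h.surjOn ⟨δ x, hx⟩
  have h1 : (s : Gsc)⁻¹ * x ∈ δ.ker := by
    rw [Hom.mem_ker, map_mul, map_inv, hs, inv_mul_cancel]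
  have h2 := mul_mem s.2 (Tsc.mem_of_mem_center (h.ker_le_center h1))
  rwa [mul_inv_cancel_left] at h2

set_option maxHeartbeats 2000000 in
/-- The kernel of a simply connected cover is a quotient of the cocharacter group, by the elements
of `p`-power order modulo the coroot lattice. -/
theorem IsSimplyConnectedCover.exists_cocharacters_to_ker [IsAlgClosed K]
    (hK : ∀ x : Kˣ, ∃ m : ℕ, (m : K) ≠ 0 ∧ x ^ m = 1) (p : ℕ) [Fact p.Prime] [CharP K p]
    (h : IsSimplyConnectedCover Tsc T δ) :
    ∃ π : T.cocharacters →* δ.ker, Function.Surjective π ∧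
      (∀ w, π (pushforwardHom δ h.mapsTo w) = 1) ∧
      (∃ a : ℕ, ∀ y, π y = 1 → ∃ w, pushforwardHom δ h.mapsTo w = y ^ p ^ a) ∧
      (∀ (F : Hom G G) (hF : ∀ t : T, F t ∈ T.toSubgroup) (Fsc : Hom Gsc Gsc),
        (∀ x, δ (Fsc x) = F (δ x)) → ∀ y, (π (pushforwardHom F hF y) : Gsc) = Fsc (π y)) := by
  have : Finite δ.ker := h.isogeny.2
  set push := pushforwardHom δ h.mapsTo with hpush
  have hinj : Function.Injective push := pushforwardHom_injective δ h.mapsTo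
  -- The exponent n = p ^ a * N kills Y(T)/Y(T_sc). `W y` is the unique lift of n y, and π evaluates
  -- it at a primitive N-th root of unity ζ; the factor p ^ a cannot be seen by points.
  obtain ⟨n, hn0, hn⟩ := exists_pow_mem_pushforward δ h.mapsTo h.surjOn
  choose W hW' using hn
  have hW : ∀ y, push (W y) = y ^ n := hW'
  obtain ⟨a, N, hpN, rfl⟩ := Nat.exists_eq_pow_mul_and_not_dvd hn0 p (Fact.out : p.Prime).ne_one
  have hNK : (N : K) ≠ 0 := by rwa [Ne, CharP.cast_eq_zero_iff K p]
  have hN0 : N ≠ 0 := fun h => hNK (by simp [h])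
  obtain ⟨ζ, hζ⟩ := exists_unit_isPrimitiveRoot hNK
  have hker : ∀ y, ((W y).1 ζ : Gsc) ∈ δ.ker := by
    intro y
    rw [Hom.mem_ker, ← pushforwardHom_apply δ h.mapsTo, ← hpush, hW]
    change ((y.1 ζ ^ (p ^ a * N) : T) : G) = 1
    rw [← map_pow, pow_mul', hζ.pow_eq_one, one_pow, map_one]
    rfl
  have hWmul : ∀ y y', W (y * y') = W y * W y' := fun y y' => hinj (by
    rw [map_mul, hW, hW, hW, mul_pow])
  let π : T.cocharacters →* δ.ker := MonoidHom.mk' (fun y => ⟨_, hker y⟩) fun y y' => by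
    apply Subtype.ext
    change (((W (y * y')).1 ζ : Tsc) : Gsc) = (W y).1 ζ * (W y').1 ζ
    rw [hWmul]
    rfl
  have hπ : ∀ y, (π y : Gsc) = (W y).1 ζ := fun y => rfl
  refine ⟨π, ?_, ?_, ⟨a, ?_⟩, ?_⟩
  · rintro ⟨x, hx⟩
    obtain ⟨t, rfl⟩ : ∃ t : Tsc, (t : Gsc) = x :=
      ⟨⟨x, Tsc.mem_of_mem_center (h.ker_le_center hx)⟩, rfl⟩
    obtain ⟨m, hm, htm⟩ := Tsc.exists_pow_eq_one hK t
    have hm0 : m ≠ 0 := fun h => hm (by simp [h])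
    have hlift : ∀ (M : ℕ) (ξ : Kˣ), IsPrimitiveRoot ξ M → ∀ w : Tsc.cocharacters,
        w.1 ξ = t → ∃ y, push w = y ^ M := by
      intro M ξ hξ w hw
      refine T.exists_pow_eq_cocharacter hξ _ (Subtype.ext ?_)
      rw [hpush, pushforwardHom_apply, hw]
      exact hx
    -- The order m of t is not yet known to divide N, so t is first written as w(ξ) with ξ of order
    -- m N. Comparing `W y` with w bounds the order of t ^ N by a power of p, while t has order
    -- prime to p.
    have htN : t ^ N = 1 := by
      have hmN : ((m * N : ℕ) : K) ≠ 0 := by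
        rw [Nat.cast_mul]; exact mul_ne_zero hm hNK
      obtain ⟨ξ, hξ⟩ := exists_unit_isPrimitiveRoot hmN
      obtain ⟨w, hw⟩ := Tsc.exists_cocharacter_apply_eq (mul_ne_zero hm0 hN0) hξ t
        (by rw [pow_mul, htm, one_pow])
      obtain ⟨y, hy⟩ := hlift _ ξ hξ w hw
      have h1 : W y ^ m = w ^ p ^ a := by
        apply Tsc.cocharacter_pow_injective hN0
        apply hinj
        rw [← pow_mul, ← pow_mul, map_pow, map_pow, hW, hy, ← pow_mul, ← pow_mul, mul_comm]
      refine eq_one_of_pow_prime_pow_eq_one (K := K) (p := p) (a := a) hm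
        (by rw [← pow_mul, mul_comm, pow_mul, htm, one_pow]) ?_
      have h2 : (W y).1 ξ ^ m = w.1 ξ ^ p ^ a :=
        DFunLike.congr_fun (congrArg Subtype.val h1) ξ
      rw [← pow_mul, mul_comm, pow_mul, ← hw, ← h2, ← pow_mul, ← map_pow, hξ.pow_eq_one, map_one]
    obtain ⟨w, hw⟩ := Tsc.exists_cocharacter_apply_eq hN0 hζ t htN
    obtain ⟨y, hy⟩ := hlift _ ζ hζ w hw
    have h1 : W y = w ^ p ^ a := hinj (by rw [hW, map_pow, hy, ← pow_mul, mul_comm])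
    -- Evaluation at ζ produces only t ^ p ^ a; since p ^ a is prime to the order of t, a further
    -- power recovers t.
    have h2 : π y = (⟨t, hx⟩ : δ.ker) ^ p ^ a := by
      apply Subtype.ext
      rw [hπ, h1]
      have h3 : w.1 ζ ^ p ^ a = t ^ p ^ a := by rw [hw]
      exact congrArg (fun s : Tsc => (s : Gsc)) h3
    have hcop : (p ^ a).Coprime (orderOf (⟨t, hx⟩ : δ.ker)) := by
      refine Nat.Coprime.pow_left a ?_
      rw [(Fact.out : p.Prime).coprime_iff_not_dvd, ← CharP.cast_eq_zero_iff K p]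
      intro h0
      have h3 : (t : Gsc) ^ m = 1 := congrArg (fun s : Tsc => (s : Gsc)) htm
      obtain ⟨c, hc⟩ := orderOf_dvd_of_pow_eq_one (x := (⟨t, hx⟩ : δ.ker)) (n := m)
        (Subtype.ext h3)
      exact hm (by rw [hc, Nat.cast_mul, h0, zero_mul])
    obtain ⟨j, hj⟩ := exists_pow_eq_self_of_coprime hcop
    exact ⟨y ^ j, by rw [map_pow, h2, hj]⟩
  · intro w
    have h1 : W (push w) = w ^ (p ^ a * N) := hinj (by rw [hW, map_pow])
    apply Subtype.ext
    rw [hπ, h1]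
    change ((w.1 ζ ^ (p ^ a * N) : Tsc) : Gsc) = 1
    rw [← map_pow, pow_mul', hζ.pow_eq_one, one_pow, map_one]
    rfl
  · intro y hy
    have hy' : ((W y).1 ζ : Gsc) = 1 := congrArg (fun x : δ.ker => (x : Gsc)) hy
    obtain ⟨w, hw⟩ := Tsc.exists_pow_eq_cocharacter hζ (W y) (Subtype.ext hy')
    refine ⟨w, T.cocharacter_pow_injective hN0 ?_⟩
    rw [← map_pow, ← hw, hW, pow_mul]
  · intro F hF Fsc hFsc y
    have hst : ∀ t : Tsc, Fsc t ∈ Tsc.toSubgroup := by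
      intro t
      apply h.mem_of_map_mem
      rw [hFsc]
      exact hF ⟨_, h.mapsTo t⟩
    have hcomm : ∀ w, push (pushforwardHom Fsc hst w) = pushforwardHom F hF (push w) := by
      intro w
      apply Subtype.ext
      ext z : 2
      exact hFsc _
    have h1 : W (pushforwardHom F hF y) = pushforwardHom Fsc hst (W y) :=
      hinj (by rw [hcomm, hW, hW, map_pow])
    rw [hπ, h1]
    rfl

set_option maxHeartbeats 2000000 in
/-- The centre of a group is dual to the kernel of the simply connected cover of a group in
duality with it, compatibly with the Frobenius endomorphisms. -/
theorem IsSimplyConnectedCover.exists_center_mulEquiv [IsAlgClosed K]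
    (hK : ∀ x : Kˣ, ∃ m : ℕ, (m : K) ≠ 0 ∧ x ^ m = 1) (p : ℕ) [Fact p.Prime] [CharP K p]
    (h : IsSimplyConnectedCover Tsc T δ) {G' : LinearAlgebraicGroup K} (hG' : G'.IsConnectedGroup)
    {T' : MaximalTorus G'} (ψ : T'.characters ≃* T.cocharacters)
    (hψ : Set.BijOn ψ T'.roots T.coroots) (F : Hom G G) (hF : ∀ t : T, F t ∈ T.toSubgroup)
    (F' : Hom G' G') (hF' : ∀ t : T', F' t ∈ T'.toSubgroup)
    (hψF : ∀ η, ψ (pullback F' hF' η) = pushforward F hF (ψ η))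
    (Fsc : Hom Gsc Gsc) (hFsc : ∀ x, δ (Fsc x) = F (δ x)) :
    ∃ E : Subgroup.center G' ≃* (δ.ker →* Kˣ), ∀ z : Subgroup.center G',
      ∃ hz : F' z ∈ Subgroup.center G', ∀ (x : δ.ker) (hx : Fsc x ∈ δ.ker),
        E ⟨F' z, hz⟩ x = E z ⟨Fsc x, hx⟩ := by
  obtain ⟨π, hπ, hπ1, ⟨a, hπa⟩, hπF⟩ := h.exists_cocharacters_to_ker hK p
  -- ψ matches roots with coroots, and the coroots of T_sc span Y(T_sc). So killing all roots
  -- amounts to killing the whole image lattice.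
  have hcenter : ∀ t : T', (t : G') ∈ Subgroup.center G' ↔
      ∀ w, (ψ.symm (pushforwardHom δ h.mapsTo w)).1 t = 1 := by
    intro t
    rw [T'.mem_center_iff hG' hK]
    constructor
    · intro ht w
      have hw : w ∈ Subgroup.closure Tsc.coroots := by rw [h.simplyConnected]; trivial
      induction hw using Subgroup.closure_induction with
      | mem l hl =>
        obtain ⟨α, hα, hαl⟩ := hψ.surjOn (h.coroots_bijOn.mapsTo hl)
        have h1 : ψ.symm (pushforwardHom δ h.mapsTo l) = α := by
          rw [MulEquiv.symm_apply_eq]; exact hαl.symm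
        rw [h1]
        exact ht α hα
      | one => rw [map_one, map_one]; rfl
      | mul v w _ _ hv hw =>
        rw [map_mul, map_mul]
        exact (congrArg₂ (· * ·) hv hw).trans (mul_one 1)
      | inv v _ hv =>
        rw [map_inv, map_inv]
        exact (congrArg (·⁻¹) hv).trans inv_one
    · intro ht α hα
      obtain ⟨l, -, hl⟩ := h.coroots_bijOn.surjOn (hψ.mapsTo hα)
      have h1 : ψ.symm (pushforwardHom δ h.mapsTo l) = α := by
        rw [MulEquiv.symm_apply_eq]; exact hl
      rw [← h1]
      exact ht l
  choose b hb using fun g : δ.ker →* Kˣ =>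
    T'.exists_forall_character_eq ((g.comp π).comp ψ.toMonoidHom)
  have hb' : ∀ (g : δ.ker →* Kˣ) (χ : T'.characters), χ.1 (b g) = g (π (ψ χ)) := hb
  have hbc : ∀ g, (b g : G') ∈ Subgroup.center G' := by
    intro g
    rw [hcenter]
    intro w
    rw [hb', MulEquiv.apply_symm_apply, hπ1, map_one]
  let B : (δ.ker →* Kˣ) →* Subgroup.center G' := MonoidHom.mk' (fun g => ⟨b g, hbc g⟩) (by
    intro g g'
    apply Subtype.ext
    change ((b (g * g') : T') : G') = ((b g * b g' : T') : G')
    congr 1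
    apply T'.eq_of_forall_character
    intro χ
    rw [map_mul, hb', hb', hb', MonoidHom.mul_apply])
  have hB : ∀ g, (B g : G') = b g := fun g => rfl
  have hBbij : Function.Bijective B := by
    constructor
    · intro g g' hgg
      have h1 : b g = b g' :=
        Subtype.ext (congrArg (fun x : Subgroup.center G' => (x : G')) hgg)
      ext x : 1
      obtain ⟨y, rfl⟩ := hπ x
      rw [← ψ.apply_symm_apply y, ← hb', ← hb', h1]
    · rintro ⟨z, hz⟩
      obtain ⟨t, rfl⟩ : ∃ t : T', (t : G') = z := ⟨⟨z, T'.mem_of_mem_center hz⟩, rfl⟩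
      let ev : T.cocharacters →* Kˣ :=
        { toFun := fun y => (ψ.symm y).1 t
          map_one' := by rw [map_one]; rfl
          map_mul' := fun x y => by rw [map_mul]; rfl }
      have hev : π.ker ≤ ev.ker := by
        intro y hy
        obtain ⟨w, hw⟩ := hπa y hy
        obtain ⟨m, hm, htm⟩ := hK (ev y)
        refine eq_one_of_pow_prime_pow_eq_one (K := K) (p := p) (a := a) hm htm ?_
        rw [← map_pow, ← hw]
        exact (hcenter t).1 hz w
      let g := π.liftOfRightInverse _ (Function.rightInverse_surjInv hπ) ⟨ev, hev⟩
      have hg : ∀ y, g (π y) = ev y := fun y => π.liftOfRightInverse_comp_apply _ _ ⟨ev, hev⟩ y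
      refine ⟨g, Subtype.ext ?_⟩
      rw [hB]
      congr 1
      apply T'.eq_of_forall_character
      intro χ
      rw [hb', hg]
      change (ψ.symm (ψ χ)).1 t = _
      rw [MulEquiv.symm_apply_apply]
  let E := (MulEquiv.ofBijective B hBbij).symm
  have hE : ∀ (t : T') (ht : (t : G') ∈ Subgroup.center G') (χ : T'.characters),
      E ⟨t, ht⟩ (π (ψ χ)) = χ.1 t := by
    intro t ht χ
    have h1 : B (E ⟨t, ht⟩) = ⟨t, ht⟩ := (MulEquiv.ofBijective B hBbij).apply_symm_apply _
    have h2 : b (E ⟨t, ht⟩) = t :=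
      Subtype.ext (congrArg (fun x : Subgroup.center G' => (x : G')) h1)
    rw [← hb', h2]
  refine ⟨E, ?_⟩
  rintro ⟨z, hz⟩
  obtain ⟨t, rfl⟩ : ∃ t : T', (t : G') = z := ⟨⟨z, T'.mem_of_mem_center hz⟩, rfl⟩
  let t' : T' := ⟨F' t, hF' t⟩
  have ht' : ∀ χ : T'.characters, χ.1 t' = (pullback F' hF' χ).1 t := fun χ => rfl
  have hst : ∀ t : Tsc, Fsc t ∈ Tsc.toSubgroup := by
    intro t
    apply h.mem_of_map_mem
    rw [hFsc]
    exact hF ⟨_, h.mapsTo t⟩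
  have hz' : (t' : G') ∈ Subgroup.center G' := by
    rw [hcenter]
    intro w
    have h1 : pullback F' hF' (ψ.symm (pushforwardHom δ h.mapsTo w)) =
        ψ.symm (pushforwardHom δ h.mapsTo (pushforwardHom Fsc hst w)) := by
      rw [← MulEquiv.symm_apply_eq, MulEquiv.symm_symm, hψF, MulEquiv.apply_symm_apply]
      apply Subtype.ext
      ext z : 2
      exact (hFsc _).symm
    rw [ht', h1]
    exact (hcenter t).1 hz _
  refine ⟨hz', fun x hx => ?_⟩
  obtain ⟨y, rfl⟩ := hπ x
  obtain ⟨χ, rfl⟩ := ψ.surjective y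
  have h1 : (⟨Fsc (π (ψ χ)), hx⟩ : δ.ker) = π (ψ (pullback F' hF' χ)) := by
    apply Subtype.ext
    rw [hψF]
    exact (hπF F hF Fsc hFsc (ψ χ)).symm
  rw [h1, hE t hz]
  exact hE t' hz' χ

end

/-! ### Counting fixed points -/

section

variable {K : Type*} [Field K]

theorem cast_exponent_ne_zero {C : Type*} [Group C] [Finite C]
    (h : ∀ x : C, ∃ m : ℕ, (m : K) ≠ 0 ∧ x ^ m = 1) : (Monoid.exponent C : K) ≠ 0 := by
  have : Fintype C := Fintype.ofFinite C
  choose m hm hxm using h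
  obtain ⟨c, hc⟩ : Monoid.exponent C ∣ ∏ x, m x := by
    rw [Monoid.exponent_dvd_iff_forall_pow_eq_one]
    intro x
    obtain ⟨c, hc⟩ := Finset.dvd_prod_of_mem m (Finset.mem_univ x)
    rw [hc, pow_mul, hxm, one_pow]
  have h1 : ((∏ x, m x : ℕ) : K) ≠ 0 := by
    rw [Nat.cast_prod]
    exact Finset.prod_ne_zero_iff.2 fun x _ => hm x
  intro h2
  exact h1 (by rw [hc, Nat.cast_mul, h2, zero_mul])

/-- An endomorphism of a finite abelian group has as many fixed points as its dual. -/
theorem card_fixed_characters [IsAlgClosed K] {C : Type*} [CommGroup C] [Finite C]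
    (h : ∀ x : C, ∃ m : ℕ, (m : K) ≠ 0 ∧ x ^ m = 1) (f : C →* C) :
    Nat.card {g : C →* Kˣ // g.comp f = g} = Nat.card {x : C // f x = x} := by
  let d : C →* C := f / MonoidHom.id C
  have hd : ∀ x, d x = f x / x := fun x => rfl
  -- Fixed characters are those trivial on the image of d : x ↦ f(x)/x. Their number is |C / im d| =
  -- |ker d|, and ker d is the set of fixed points of f.
  let e : {g : C →* Kˣ // g.comp f = g} ≃ (C ⧸ d.range →* Kˣ) :=
    { toFun := fun g => QuotientGroup.lift d.range g.1 (by
        rintro _ ⟨x, rfl⟩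
        rw [hd, MonoidHom.mem_ker, map_div, div_eq_one]
        exact DFunLike.congr_fun g.2 x)
      invFun := fun φ => ⟨φ.comp (QuotientGroup.mk' d.range), by
        ext x : 1
        have h1 : (QuotientGroup.mk' d.range) (f x / x) = 1 :=
          (QuotientGroup.eq_one_iff _).2 ⟨x, rfl⟩
        rw [map_div, div_eq_one] at h1
        simp only [MonoidHom.comp_apply, h1]⟩
      left_inv := fun g => Subtype.ext (MonoidHom.ext fun x => rfl)
      right_inv := fun φ => by
        ext x
        rfl }
  have : NeZero (Monoid.exponent (C ⧸ d.range) : K) := ⟨cast_exponent_ne_zero fun x => by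
    obtain ⟨x, rfl⟩ := QuotientGroup.mk_surjective x
    obtain ⟨m, hm, hx⟩ := h x
    exact ⟨m, hm, by rw [← QuotientGroup.mk_pow, hx, QuotientGroup.mk_one]⟩⟩
  rw [Nat.card_congr e, CommGroup.card_monoidHom_of_hasEnoughRootsOfUnity]
  have h1 : Nat.card {x : C // f x = x} = Nat.card d.ker :=
    Nat.card_congr (Equiv.subtypeEquivRight fun x => by rw [MonoidHom.mem_ker, hd, div_eq_one])
  have h2 := Subgroup.card_eq_card_quotient_mul_card_subgroup d.ker
  have h3 := Subgroup.card_eq_card_quotient_mul_card_subgroup d.range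
  rw [Nat.card_congr (QuotientGroup.quotientKerEquivRange d).toEquiv] at h2
  rw [h1]
  have h4 : 0 < Nat.card d.range := Nat.card_pos
  exact Nat.eq_of_mul_eq_mul_right h4 (by rw [← h3, h2, mul_comm])

theorem card_pow_fixed_eq_of_isCyclic {A Z : Type*} [Group A] [Group Z] [IsCyclic A] [IsCyclic Z]
    (h : Nat.card A = Nat.card Z) (k : ℤ) :
    Nat.card {x : A // x ^ k = x} = Nat.card {z : Z // z ^ k = z} := by
  let e := mulEquivOfCyclicCardEq h
  exact Nat.card_congr (e.toEquiv.subtypeEquiv fun x => by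
    change x ^ k = x ↔ e x ^ k = e x
    rw [← map_zpow, e.injective.eq_iff])

/-- The subtype of fixed points of `F` in a subgroup `A`, when `F` preserves `A`. -/
theorem card_fixed_subgroup {G : Type*} [Group G] (A : Subgroup G) (F : G → G) (f : A → A)
    (hf : ∀ x, (f x : G) = F x) :
    Nat.card {x : G // x ∈ A ∧ F x = x} = Nat.card {x : A // f x = x} :=
  Nat.card_congr
    { toFun := fun x => ⟨⟨x, x.2.1⟩, Subtype.ext ((hf _).trans x.2.2)⟩
      invFun := fun x => ⟨x.1, x.1.2, (hf x.1).symm.trans (congrArg Subtype.val x.2)⟩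
      left_inv := fun _ => rfl
      right_inv := fun _ => rfl }

variable {Gsc G : LinearAlgebraicGroup K} {Tsc : MaximalTorus Gsc} {T : MaximalTorus G}
  {δ : Hom Gsc G}

/-- The endomorphism of the kernel of a cover induced by compatible endomorphisms. -/
def kerEndo {F : Hom G G} {Fsc : Hom Gsc Gsc} (hFsc : ∀ x, δ (Fsc x) = F (δ x)) :
    δ.ker →* δ.ker where
  toFun x := ⟨Fsc x, by rw [Hom.mem_ker, hFsc, Hom.mem_ker.1 x.2, map_one]⟩
  map_one' := Subtype.ext (map_one Fsc.toMonoidHom)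
  map_mul' x y := Subtype.ext (map_mul Fsc.toMonoidHom (x : Gsc) y)

theorem IsSimplyConnectedCover.ker_comm (h : IsSimplyConnectedCover Tsc T δ) (x y : δ.ker) :
    x * y = y * x :=
  Subtype.ext (Subgroup.mem_center_iff.1 (h.ker_le_center y.2) x)

theorem IsSimplyConnectedCover.exists_pow_eq_one_of_ker (h : IsSimplyConnectedCover Tsc T δ)
    (hK : ∀ x : Kˣ, ∃ m : ℕ, (m : K) ≠ 0 ∧ x ^ m = 1) (x : δ.ker) :
    ∃ m : ℕ, (m : K) ≠ 0 ∧ x ^ m = 1 := by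
  obtain ⟨m, hm, hx⟩ := Tsc.exists_pow_eq_one hK ⟨x, Tsc.mem_of_mem_center (h.ker_le_center x.2)⟩
  have hx' : (x : Gsc) ^ m = 1 := congrArg (fun t : Tsc => (t : Gsc)) hx
  exact ⟨m, hm, Subtype.ext hx'⟩

theorem IsSimplyConnectedCover.card_ker_fixed [IsAlgClosed K]
    (h : IsSimplyConnectedCover Tsc T δ)
    (hK : ∀ x : Kˣ, ∃ m : ℕ, (m : K) ≠ 0 ∧ x ^ m = 1)
    {F : Hom G G} {Fsc : Hom Gsc Gsc} (hFsc : ∀ x, δ (Fsc x) = F (δ x))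
    {G' : LinearAlgebraicGroup K} {F' : Hom G' G'}
    (E : Subgroup.center G' ≃* (δ.ker →* Kˣ))
    (hE : ∀ z : Subgroup.center G', ∃ hz : F' z ∈ Subgroup.center G', ∀ (x : δ.ker)
      (hx : Fsc x ∈ δ.ker), E ⟨F' z, hz⟩ x = E z ⟨Fsc x, hx⟩) :
    Nat.card {x : Gsc // x ∈ δ.ker ∧ Fsc x = x} =
      Nat.card {z : G' // z ∈ Subgroup.center G' ∧ F' z = z} := by
  have : Finite δ.ker := h.isogeny.2
  choose hz hE using hE
  rw [card_fixed_subgroup δ.ker Fsc (kerEndo hFsc) fun _ => rfl,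
    card_fixed_subgroup (Subgroup.center G') F' (fun z => ⟨F' z, hz z⟩) fun _ => rfl]
  have h1 : Nat.card {z : Subgroup.center G' // (⟨F' z, hz z⟩ : Subgroup.center G') = z} =
      Nat.card {g : δ.ker →* Kˣ // g.comp (kerEndo hFsc) = g} :=
    Nat.card_congr (E.toEquiv.subtypeEquiv fun z => by
      rw [← E.injective.eq_iff]
      have h2 : E ⟨F' z, hz z⟩ = (E z).comp (kerEndo hFsc) :=
        MonoidHom.ext fun x => hE z x (kerEndo hFsc x).2
      rw [h2]
      rfl)
  rw [h1]
  let : CommGroup δ.ker := { (inferInstance : Group δ.ker) with mul_comm := h.ker_comm }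
  exact (card_fixed_characters (h.exists_pow_eq_one_of_ker hK) (kerEndo hFsc)).symm

/-- An endomorphism of a cyclic group is a power map, and duality preserves the exponent. It thus
acts on A and on Z by the same power, and these are isomorphic cyclic groups. -/
theorem IsSimplyConnectedCover.card_subgroup_fixed [IsAlgClosed K]
    (h : IsSimplyConnectedCover Tsc T δ)
    (hK : ∀ x : Kˣ, ∃ m : ℕ, (m : K) ≠ 0 ∧ x ^ m = 1)
    {F : Hom G G} {Fsc : Hom Gsc Gsc} (hFsc : ∀ x, δ (Fsc x) = F (δ x))
    {G' : LinearAlgebraicGroup K} {F' : Hom G' G'}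
    (E : Subgroup.center G' ≃* (δ.ker →* Kˣ))
    (hE : ∀ z : Subgroup.center G', ∃ hz : F' z ∈ Subgroup.center G', ∀ (x : δ.ker)
      (hx : Fsc x ∈ δ.ker), E ⟨F' z, hz⟩ x = E z ⟨Fsc x, hx⟩)
    (hcyc : IsCyclic (Subgroup.center G')) {A : Subgroup Gsc} {Z : Subgroup G'}
    (hA : A ≤ δ.ker) (hZ : Z ≤ Subgroup.center G') (hAZ : Nat.card A = Nat.card Z) :
    Nat.card {x : Gsc // x ∈ A ∧ Fsc x = x} = Nat.card {z : G' // z ∈ Z ∧ F' z = z} := by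
  have : Finite δ.ker := h.isogeny.2
  -- The kernel is isomorphic to its character group, since its exponent is invertible in K; that
  -- group is the cyclic centre.
  have hker : IsCyclic δ.ker := by
    have h1 : IsCyclic (δ.ker →* Kˣ) := isCyclic_of_surjective E E.surjective
    let : CommGroup δ.ker := { (inferInstance : Group δ.ker) with mul_comm := h.ker_comm }
    have : NeZero (Monoid.exponent δ.ker : K) :=
      ⟨cast_exponent_ne_zero (h.exists_pow_eq_one_of_ker hK)⟩
    obtain ⟨e⟩ := CommGroup.monoidHom_mulEquiv_of_hasEnoughRootsOfUnity δ.ker K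
    exact isCyclic_of_surjective e e.surjective
  obtain ⟨k, hk⟩ := MonoidHom.map_cyclic (kerEndo hFsc)
  have hk1 : ∀ x ∈ δ.ker, Fsc x = x ^ k := fun x hx =>
    congrArg (fun y : δ.ker => (y : Gsc)) (hk ⟨x, hx⟩)
  have hk2 : ∀ z ∈ Subgroup.center G', F' z = z ^ k := by
    intro z hz
    obtain ⟨hz', hzE⟩ := hE ⟨z, hz⟩
    have h1 : (⟨F' z, hz'⟩ : Subgroup.center G') = ⟨z, hz⟩ ^ k := by
      apply E.injective
      rw [map_zpow]
      ext x : 1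
      rw [hzE x (kerEndo hFsc x).2]
      exact (congrArg (E ⟨z, hz⟩) (hk x)).trans (map_zpow _ _ _)
    exact congrArg (fun y : Subgroup.center G' => (y : G')) h1
  have hAc : IsCyclic A := isCyclic_of_injective _ (Subgroup.inclusion_injective hA)
  have hZc : IsCyclic Z := isCyclic_of_injective _ (Subgroup.inclusion_injective hZ)
  rw [card_fixed_subgroup A Fsc (fun x => x ^ k) fun x => (hk1 x (hA x.2)).symm,
    card_fixed_subgroup Z F' (fun z => z ^ k) fun z => (hk2 z (hZ z.2)).symm]
  exact card_pow_fixed_eq_of_isCyclic hAZ k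

/-- The transpose of the duality isomorphism is also compatible with the endomorphisms. -/
theorem transpose_pullback_eq {G' : LinearAlgebraicGroup K} {T' : MaximalTorus G'} {F : Hom G G}
    {F' : Hom G' G'} {hF : ∀ t : T, F t ∈ T.toSubgroup} {hF' : ∀ t : T', F' t ∈ T'.toSubgroup}
    {φ : T.characters ≃* T'.cocharacters} {ψ : T'.characters ≃* T.cocharacters}
    (hφψ : ∀ (χ : T.characters) (η : T'.characters) (c : Kˣ), χ.1 ((ψ η).1 c) = η.1 ((φ χ).1 c))
    (hφ : ∀ χ : T.characters, φ (pullback F hF χ) = pushforward F' hF' (φ χ))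
    (η : T'.characters) : ψ (pullback F' hF' η) = pushforward F hF (ψ η) := by
  apply Subtype.ext
  ext z : 1
  apply T.eq_of_forall_character
  intro χ
  rw [hφψ]
  change _ = (pullback F hF χ).1 ((ψ η).1 z)
  rw [hφψ, hφ]
  rfl

end

end LinearAlgebraicGroup

/-! ### The main theorem. -/

theorem mainTheorem8 {p : ℕ} [Fact p.Prime] {K : Type*} [Field K] [Algebra (ZMod p) K]
    [IsAlgClosure (ZMod p) K] (q a : ℕ) (ha : 0 < a) (hq : q = p ^ a)
    (G Gd : LinearAlgebraicGroup K) (hG : G.IsSimple) (hGd : Gd.IsReductive)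
    (T : LinearAlgebraicGroup.MaximalTorus G) (Td : LinearAlgebraicGroup.MaximalTorus Gd)
    (F : LinearAlgebraicGroup.Hom G G) (hF : F.IsFrobenius q)
    (Fd : LinearAlgebraicGroup.Hom Gd Gd) (hFd : Fd.IsFrobenius q)
    (hdual : LinearAlgebraicGroup.InDuality T F Td Fd) :
    (∀ (Gsc : LinearAlgebraicGroup K) (Tsc : LinearAlgebraicGroup.MaximalTorus Gsc)
      (δ : LinearAlgebraicGroup.Hom Gsc G) (Fsc : LinearAlgebraicGroup.Hom Gsc Gsc),
      LinearAlgebraicGroup.IsSimplyConnectedCover Tsc T δ → Fsc.IsFrobenius q →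
      (∀ x, δ (Fsc x) = F (δ x)) →
      Nat.card {x : Gsc // x ∈ δ.ker ∧ Fsc x = x} =
        Nat.card {z : Gd // z ∈ Subgroup.center Gd ∧ Fd z = z}) ∧
    (∀ (Gdsc : LinearAlgebraicGroup K) (Tdsc : LinearAlgebraicGroup.MaximalTorus Gdsc)
      (δd : LinearAlgebraicGroup.Hom Gdsc Gd) (Fdsc : LinearAlgebraicGroup.Hom Gdsc Gdsc),
      LinearAlgebraicGroup.IsSimplyConnectedCover Tdsc Td δd → Fdsc.IsFrobenius q →
      (∀ x, δd (Fdsc x) = Fd (δd x)) →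
      IsCyclic (Subgroup.center G) →
      ∀ (A : Subgroup Gdsc) (Z : Subgroup G), A ≤ δd.ker → Z ≤ Subgroup.center G →
        Nat.card A = Nat.card Z →
        Nat.card {x : Gdsc // x ∈ A ∧ Fdsc x = x} = Nat.card {z : G // z ∈ Z ∧ F z = z}) := by

  have hcl : IsAlgClosed K := IsAlgClosure.isAlgClosed (ZMod p)
  have : Algebra.IsAlgebraic (ZMod p) K := IsAlgClosure.isAlgebraic
  have : CharP K p := charP_of_injective_algebraMap (algebraMap (ZMod p) K).injective p
  have hK : ∀ x : Kˣ, ∃ m : ℕ, (m : K) ≠ 0 ∧ x ^ m = 1 :=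
    LinearAlgebraicGroup.exists_pow_eq_one_of_isAlgebraic p
  obtain ⟨hFT, hFdT, φ, ψ, hφψ, hφ, hψ, -, hφF⟩ := hdual
  refine ⟨fun Gsc Tsc δ Fsc hδ _ hFsc => ?_,
    fun Gdsc Tdsc δd Fdsc hδ _ hFsc hcyc A Z hA hZ hAZ => ?_⟩
  -- The duality hypothesis gives equivariance for φ only, so here the transpose ψ needs
  -- `transpose_pullback_eq`.
  · obtain ⟨E, hE⟩ := hδ.exists_center_mulEquiv hK p hGd.connected ψ hψ F hFT Fd hFdT
      (LinearAlgebraicGroup.transpose_pullback_eq hφψ hφF) Fsc hFsc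
    exact hδ.card_ker_fixed hK hFsc E hE
  -- Same duality with the two groups exchanged: the cover is now that of the dual group and φ takes
  -- the place of ψ.
  · obtain ⟨E, hE⟩ := hδ.exists_center_mulEquiv hK p hG.connected φ hφ Fd hFdT F hFT
      hφF Fdsc hFsc
    exact hδ.card_subgroup_fixed hK hFsc E hE hcyc hA hZ hAZ
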